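/- Let $n\ge 2$ and let $\mathcal K(\mathbb R^n)$ be the set of convex bodies (non-empty compact convex sets) in $\mathbb R^n$ with the Hausdorff metric. For $K\in\mathcal K(\mathbb R^n)$ let $h_K(u)=\sup_{y\in K}\langle u,y\rangle$ be its support function, and let the surface area measure $S_{n-1}(K)$ be the finite Borel measure on $S^{n-1}$ determined by $\frac{d}{dt}\big|_{t=0^+}\mathrm{vol}_n(K+tL)=\int_{S^{n-1}}h_L\,dS_{n-1}(K)$ for all $L\in\mathcal K(\mathbb R^n)$. Let $$S(L_1,\dots,L_{n-1})=\frac1{(n-1)!}\frac{\partial^{n-1}}{\partial\lambda_1\cdots\partial\lambda_{n-1}}\Big|_{0}S_{n-1}\Big(\sum_{i=1}^{n-1}\lambda_iL_i\Big)$$ (in the weak sense; the right-hand measure is polynomial in $\lambda_i\ge0$) be the mixed area measure, and let $S_1(K)=S(K,B,\dots,B)$ be the first area measure, where $B$ is the closed unit ball and occurs $n-2$ times. Let $\mathrm{Val}_1(\mathbb R^n)$ be the space of continuous, translation invariant, $1$-homogeneous (that is, $\mu(tK)=t\mu(K)$ for $t\ge0$) real-valued valuations on $\mathcal K(\mathbb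 R^n)$, where $\mu$ is a valuation if $\mu(K)+\mu(L)=\mu(K\cup L)+\mu(K\cap L)$ whenever $K\cup L$ is convex. A valuation $\mu\in\mathrm{Val}_1(\mathbb R^n)$ is called uniformly continuous if there is a constant $C$ with $$|\mu(K)-\mu(L)|\le C\,\|h_K-h_L\|_\infty=C\sup_{u\in S^{n-1}}|h_K(u)-h_L(u)|\qquad\text{for all }K,L\in\mathcal K(\mathbb R^n)$$ (for $1$-homogeneous $\mu$ this is the same as uniform continuity with respect to the Hausdorff metric). Lemma. Let $\psi\in C^\infty([-1,1])$ be a real-valued function with $\psi(t)=0$ for $|t|\ge\frac23$ and $\psi(t)=1$ for $|t|\le\frac13$, and let $f(t)=\sqrt{|t|}\,(1-t^2)^{-\frac{n-3}2}\psi(t)$ for $t\in[-1,1]$ (with $f(\pm1)=0$). Then $$\mu(K)=\int_{S^{n-1}}f(x_n)\,dS_1(K,x),\qquad K\in\mathcal K(\mathbb R^n),$$ defines a valuation $\mu\in\mathrm{Val}_1(\mathbb R^n)$, and $\mu$ is not uniformly continuous. -/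

import Mathlib

open MeasureTheory
open scoped ContDiff

noncomputable section

namespace AreaVal

/-- Euclidean space of dimension `n`. -/
abbrev E (n : ℕ) : Type := EuclideanSpace ℝ (Fin n)

/-- The unit sphere of Euclidean space of dimension `n`. -/
abbrev Sph (n : ℕ) : Type := Metric.sphere (0 : E n) 1

/-- The convex bodies (non-empty compact convex sets), with the Hausdorff metric. -/
abbrev Body (n : ℕ) : Type := ConvexBody (E n)

/-- The support function `h_K(u) = sup_{y ∈ K} ⟨u, y⟩`. -/
def supportFn {n : ℕ} (K : Body n) (u : E n) : ℝ :=
  sSup ((fun y : E n => inner ℝ u y) '' (K : Set (E n)))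

/-- The closed unit ball centred at the origin, as a convex body. -/
def unitBall (n : ℕ) : Body n where
  carrier := Metric.closedBall 0 1
  convex' := convex_closedBall 0 1
  isCompact' := isCompact_closedBall 0 1
  nonempty' := Metric.nonempty_closedBall.2 zero_le_one

/-- The one-point convex body `{x}`. -/
def pointBody {n : ℕ} (x : E n) : Body n where
  carrier := {x}
  convex' := convex_singleton x
  isCompact' := isCompact_singleton
  nonempty' := Set.singleton_nonempty x

/-- The finite Borel measure `m` on the sphere satisfies
`d/dt|_{t = 0+} vol (K + t L) = ∫ h_L dm` for all convex bodies `L`. This characterizes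
the surface area measure of `K`. -/
def IsSurfaceAreaMeasure {n : ℕ} (K : Body n) (m : Measure (Sph n)) : Prop :=
  IsFiniteMeasure m ∧ ∀ L : Body n,
    HasDerivWithinAt (fun t : ℝ => (volume : Measure (E n)).real ((K + t • L : Body n) : Set (E n)))
      (∫ u : Sph n, supportFn L (u : E n) ∂m) (Set.Ici 0) 0

open Classical in
/-- The surface area measure `S_{n-1}(K)`. -/
def surfaceAreaMeasure {n : ℕ} (K : Body n) : Measure (Sph n) :=
  if h : ∃ m : Measure (Sph n), IsSurfaceAreaMeasure K m then h.choose else 0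

/-- The finite Borel measure `m` is
`1/(n-1)! ∂^{n-1}/∂λ_1 ⋯ ∂λ_{n-1}|_0 S_{n-1}(λ_1 L_1 + ⋯ + λ_{n-1} L_{n-1})`
in the weak sense: for every continuous `g` on the sphere, the integral of `g` against
`S_{n-1}(∑ λ_i L_i)` is a polynomial `P` in `λ_1, …, λ_{n-1} ≥ 0`, and `(n-1)! ∫ g dm` is its
mixed partial derivative `∂^{n-1} P/∂λ_1 ⋯ ∂λ_{n-1}` at `0`, that is, the coefficient in `P` of the
monomial `λ_1 ⋯ λ_{n-1}`. -/
def IsMixedAreaMeasure {n : ℕ} (L : Fin (n - 1) → Body n) (m : Measure (Sph n)) : Prop :=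
  IsFiniteMeasure m ∧ ∀ g : C(Sph n, ℝ), ∃ P : MvPolynomial (Fin (n - 1)) ℝ,
    (∀ l : Fin (n - 1) → ℝ, (∀ i, 0 ≤ l i) →
      ∫ u, g u ∂(surfaceAreaMeasure (∑ i, l i • L i)) = MvPolynomial.eval l P) ∧
    ((n - 1).factorial : ℝ) * ∫ u, g u ∂m = P.coeff (∑ i, Finsupp.single i 1)

open Classical in
/-- The mixed area measure `S(L_1, …, L_{n-1})`. -/
def mixedAreaMeasure {n : ℕ} (L : Fin (n - 1) → Body n) : Measure (Sph n) :=
  if h : ∃ m : Measure (Sph n), IsMixedAreaMeasure L m then h.choose else 0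

/-- The `k`-th area measure `S_k(K) = S(K[k], B[n-k-1])`, where `B` is the unit ball
(for `k ≤ n - 1`). -/
def areaMeasure {n : ℕ} (k : ℕ) (K : Body n) : Measure (Sph n) :=
  mixedAreaMeasure (fun i : Fin (n - 1) => if (i : ℕ) < k then K else unitBall n)

/-- The space `Val_k(ℝⁿ)` of continuous, translation invariant, `k`-homogeneous, real-valued
valuations. If `K ∪ L` is convex, then it is a convex body, and so is `K ∩ L`, which is
non-empty because `K ∪ L` is connected. -/
structure IsVal {n : ℕ} (k : ℕ) (μ : Body n → ℝ) : Prop where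
  valuation : ∀ K L U I : Body n, (U : Set (E n)) = (K : Set (E n)) ∪ L →
    (I : Set (E n)) = (K : Set (E n)) ∩ L → μ K + μ L = μ U + μ I
  continuous : Continuous μ
  translation : ∀ (K : Body n) (x : E n), μ (K + pointBody x) = μ K
  homogeneous : ∀ (K : Body n) (t : ℝ), 0 ≤ t → μ (t • K) = t ^ k * μ K

/-- Uniform continuity of a functional on convex bodies (for degree one):
`|μ(K) - μ(L)| ≤ C ‖h_K - h_L‖_∞`, with the supremum norm on the unit sphere. -/
def IsUniformlyContinuous {n : ℕ} (μ : Body n → ℝ) : Prop :=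
  ∃ C : ℝ, ∀ K L : Body n,
    |μ K - μ L| ≤ C * ⨆ u : Sph n, |supportFn K (u : E n) - supportFn L (u : E n)|

/-- The function `f(t) = √|t| (1 - t²)^{-(n-3)/2} ψ(t)`. -/
def profile (n : ℕ) (ψ : ℝ → ℝ) (t : ℝ) : ℝ :=
  Real.sqrt |t| * (1 - t ^ 2) ^ (-(((n : ℝ) - 3) / 2)) * ψ t

end AreaVal

end

/-!
The proof computes with the first area measure `S₁(K)` through the mixed second variation
`mixVar K L = ∂²/∂l∂t vol (B + l K + t L)` at `0`, which equals `(n - 1) ∫ h_L dS₁(K)`.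

*Existence of the measures.* Minkowski's theorem `exists_volume_polynomial` says that
`vol (∑ l_i K_i)` is a homogeneous polynomial of degree `n` in `l ≥ 0`. Let `φ_K` be the convolution
of the support function of `K` with a smooth compactly supported density. It is smooth, convex,
additive in `K`, and its gradient maps `ℝⁿ` into `K` and onto the interior of `K`. As this gradient
is injective where the Hessian is nondegenerate, `vol K = ∫ det D²φ_K`, and
`det (∑ l_i D²φ_{K_i})` is pointwise a homogeneous polynomial. Hence the first variation
`firstVar Q L` of volume exists and is additive, homogeneous and monotone in `L`. Differences of
support functions form a dense vector lattice in `C(S^{n-1})`, so the extension theorem of M. Riesz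
and the Riesz representation theorem produce the surface area measure
(`exists_isSurfaceAreaMeasure`), and `S_{n-1}(s B + l K)` is a binary form in `(s, l)`
(`surfCLM_eq_sum`). Its coefficient `T₁` of `s^{n-2} l` is `(n - 1) S₁(K)`, provided that it is
positive. Positivity amounts to the monotonicity of `mixVar K`, and it is shown in
`firstVar_ball_sub_le` by an explicit map that does not decrease distances: a point `y` is moved to
`y + k`, where `k` is a point of `K` with outer normal `y`.

*The valuation.* By the symmetry of `mixVar`, the measure `S₁(K)` is Minkowski additive in `K` and
depends weakly continuously on `K`. The valuation property follows from
`K + L = (K ∪ L) + (K ∩ L)`, valid when the union is convex.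

*Failure of uniform continuity.* The volume of `A + s [0, v]` is affine in `s`, so that
`mixVar [0, v] [0, v] = 0` and `S₁([0, v])` is concentrated on the hyperplane orthogonal to `v`. The
function `√|x_n|` vanishes on the equator, hence the functional vanishes on `[0, e_n]`. For the
tilted segment `[0, e_n + δ² e_j]` one has `|x_n| ≤ δ²`, hence `√|x_n| ≥ |x_n| / δ`, almost
everywhere with respect to its area measure. By symmetry, the integral of `|x_n|` against this
measure is `δ²` times the integral of `|x_j|` against `S₁([0, e_n])`, and the latter is positive for
some `j`. So the value of the functional is at least of order `δ`, although the two segments are at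
distance `δ²`.
-/

noncomputable section

namespace AreaVal

open scoped Pointwise

/-! ### Support functions -/

section Support

variable {n : ℕ}

lemma bddAbove_inner_image (K : Body n) (u : E n) :
    BddAbove ((fun y : E n => inner ℝ u y) '' (K : Set (E n))) :=
  (K.isCompact.image (by fun_prop)).bddAbove

lemma inner_le_supportFn {K : Body n} {y : E n} (hy : y ∈ K) (u : E n) :
    inner ℝ u y ≤ supportFn K u :=
  le_csSup (bddAbove_inner_image K u) ⟨y, hy, rfl⟩

lemma supportFn_le {K : Body n} {u : E n} {a : ℝ} (h : ∀ y ∈ K, inner ℝ u y ≤ a) :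
    supportFn K u ≤ a :=
  csSup_le (K.nonempty.image _) (by rintro _ ⟨y, hy, rfl⟩; exact h y hy)

lemma exists_inner_eq_supportFn (K : Body n) (u : E n) : ∃ y ∈ K, inner ℝ u y = supportFn K u := by
  obtain ⟨y, hy, h⟩ := K.isCompact.exists_isMaxOn K.nonempty
    (f := fun y : E n => inner ℝ u y) (by fun_prop)
  exact ⟨y, hy, le_antisymm (inner_le_supportFn hy u) (supportFn_le fun z hz => h hz)⟩

lemma supportFn_body_add (K L : Body n) (u : E n) :
    supportFn (K + L) u = supportFn K u + supportFn L u := by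
  apply le_antisymm
  · refine supportFn_le fun y hy => ?_
    obtain ⟨a, ha, b, hb, rfl⟩ := (hy : y ∈ (K : Set (E n)) + L)
    rw [inner_add_right]
    exact add_le_add (inner_le_supportFn ha u) (inner_le_supportFn hb u)
  · obtain ⟨a, ha, ha'⟩ := exists_inner_eq_supportFn K u
    obtain ⟨b, hb, hb'⟩ := exists_inner_eq_supportFn L u
    rw [← ha', ← hb', ← inner_add_right]
    exact inner_le_supportFn (show a + b ∈ (K : Set (E n)) + L from Set.add_mem_add ha hb) u

lemma supportFn_body_smul (K : Body n) {t : ℝ} (ht : 0 ≤ t) (u : E n) :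
    supportFn (t • K) u = t * supportFn K u := by
  apply le_antisymm
  · refine supportFn_le fun y hy => ?_
    obtain ⟨a, ha, rfl⟩ := (hy : y ∈ t • (K : Set (E n)))
    rw [real_inner_smul_right]
    exact mul_le_mul_of_nonneg_left (inner_le_supportFn ha u) ht
  · obtain ⟨a, ha, ha'⟩ := exists_inner_eq_supportFn K u
    rw [← ha', ← real_inner_smul_right]
    exact inner_le_supportFn (show t • a ∈ t • (K : Set (E n)) from Set.smul_mem_smul_set ha) u

lemma supportFn_zero_body (u : E n) : supportFn (0 : Body n) u = 0 := by
  apply le_antisymm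
  · refine supportFn_le fun y hy => ?_
    have : y = 0 := hy
    simp [this]
  · simpa using inner_le_supportFn (K := (0 : Body n)) (y := 0) (show (0 : E n) ∈ (0 : Set (E n)) by simp) u

lemma supportFn_body_sum {ι : Type*} (s : Finset ι) (K : ι → Body n) (l : ι → ℝ)
    (hl : ∀ i ∈ s, 0 ≤ l i) (u : E n) :
    supportFn (∑ i ∈ s, l i • K i) u = ∑ i ∈ s, l i * supportFn (K i) u := by
  classical
  induction s using Finset.induction_on with
  | empty => simp [supportFn_zero_body]
  | insert i s hi ih =>
    rw [Finset.sum_insert hi, Finset.sum_insert hi, supportFn_body_add,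
      supportFn_body_smul _ (hl i (by simp)), ih fun j hj => hl j (by simp [hj])]

lemma supportFn_pointBody (x u : E n) : supportFn (pointBody x) u = inner ℝ u x := by
  simp [supportFn, pointBody]

lemma mem_unitBall {x : E n} : x ∈ unitBall n ↔ ‖x‖ ≤ 1 := by
  change x ∈ Metric.closedBall (0 : E n) 1 ↔ _
  simp

lemma supportFn_unitBall (u : E n) : supportFn (unitBall n) u = ‖u‖ := by
  apply le_antisymm
  · refine supportFn_le fun y hy => ?_
    have := real_inner_le_norm u y
    have h1 := mem_unitBall.1 hy
    nlinarith [norm_nonneg u]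
  · by_cases hu : u = 0
    · simpa [hu] using inner_le_supportFn (K := unitBall n) (y := 0) (mem_unitBall.2 (by simp)) (0 : E n)
    · have h0 : ‖u‖ ≠ 0 := norm_ne_zero_iff.2 hu
      have := inner_le_supportFn (K := unitBall n) (y := ‖u‖⁻¹ • u)
        (mem_unitBall.2 (by rw [norm_smul, norm_inv, norm_norm, inv_mul_cancel₀ h0])) u
      rw [real_inner_smul_right, real_inner_self_eq_norm_sq] at this
      calc ‖u‖ = ‖u‖⁻¹ * ‖u‖ ^ 2 := by field_simp
        _ ≤ _ := this

lemma supportFn_add_le (K : Body n) (u v : E n) :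
    supportFn K (u + v) ≤ supportFn K u + supportFn K v :=
  supportFn_le fun y hy => by
    rw [inner_add_left]
    exact add_le_add (inner_le_supportFn hy u) (inner_le_supportFn hy v)

lemma supportFn_smul (K : Body n) {t : ℝ} (ht : 0 ≤ t) (u : E n) :
    supportFn K (t • u) = t * supportFn K u := by
  apply le_antisymm
  · refine supportFn_le fun y hy => ?_
    rw [real_inner_smul_left]
    exact mul_le_mul_of_nonneg_left (inner_le_supportFn hy u) ht
  · obtain ⟨a, ha, ha'⟩ := exists_inner_eq_supportFn K u
    rw [← ha', ← real_inner_smul_left]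
    exact inner_le_supportFn ha _

lemma convexOn_supportFn (K : Body n) : ConvexOn ℝ Set.univ (supportFn K) := by
  refine ⟨convex_univ, fun x _ y _ a b ha hb _ => ?_⟩
  refine (supportFn_add_le K _ _).trans_eq ?_
  rw [supportFn_smul K ha, supportFn_smul K hb, smul_eq_mul, smul_eq_mul]

/-- Separation from a point: a convex body is the intersection of its supporting half-spaces. -/
lemma mem_of_forall_inner_le {K : Body n} {x : E n}
    (h : ∀ u : E n, inner ℝ u x ≤ supportFn K u) : x ∈ K := by
  by_contra hx
  obtain ⟨f, a, hfa, hfx⟩ := geometric_hahn_banach_closed_point K.convex K.isClosed hx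
  set u := (InnerProductSpace.toDual ℝ (E n)).symm f
  have hu : ∀ y, inner ℝ u y = f y := fun y => by
    simp [u]
  obtain ⟨y, hy, hy'⟩ := exists_inner_eq_supportFn K u
  have h1 := h u
  rw [← hy', hu, hu] at h1
  exact absurd (h1.trans (hfa y hy).le) (not_le.2 hfx)

lemma supportFn_eq_norm_mul (K : Body n) {u : E n} (hu : u ≠ 0) :
    supportFn K u = ‖u‖ * supportFn K (‖u‖⁻¹ • u) := by
  rw [← supportFn_smul K (norm_nonneg u), smul_inv_smul₀ (norm_ne_zero_iff.2 hu)]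

lemma normalize_mem_sphere {u : E n} (hu : u ≠ 0) : ‖u‖⁻¹ • u ∈ Metric.sphere (0 : E n) 1 := by
  rw [mem_sphere_zero_iff_norm, norm_smul, norm_inv, norm_norm,
    inv_mul_cancel₀ (norm_ne_zero_iff.2 hu)]

lemma supportFn_zero (K : Body n) : supportFn K 0 = 0 := by
  simpa using supportFn_smul K le_rfl (0 : E n)

lemma supportFn_le_of_sphere {K L : Body n} (h : ∀ u : Sph n, supportFn K u ≤ supportFn L u)
    (u : E n) : supportFn K u ≤ supportFn L u := by
  by_cases hu : u = 0
  · simp [hu, supportFn_zero]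
  · rw [supportFn_eq_norm_mul K hu, supportFn_eq_norm_mul L hu]
    exact mul_le_mul_of_nonneg_left (h ⟨_, normalize_mem_sphere hu⟩) (norm_nonneg u)

lemma subset_of_supportFn_le {K L : Body n} (h : ∀ u : Sph n, supportFn K u ≤ supportFn L u) :
    (K : Set (E n)) ⊆ L := fun _ hx =>
  mem_of_forall_inner_le fun u => (inner_le_supportFn hx u).trans (supportFn_le_of_sphere h u)

lemma eq_of_supportFn_eq {K L : Body n} (h : ∀ u : Sph n, supportFn K u = supportFn L u) :
    K = L :=
  ConvexBody.ext ((subset_of_supportFn_le fun u => (h u).le).antisymm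
    (subset_of_supportFn_le fun u => (h u).ge))

lemma exists_norm_le (K : Body n) : ∃ R : ℝ, 0 < R ∧ ∀ y ∈ K, ‖y‖ ≤ R :=
  K.isBounded.exists_pos_norm_le

lemma abs_supportFn_sub_le {K : Body n} {R : ℝ} (hR : ∀ y ∈ K, ‖y‖ ≤ R) (u v : E n) :
    |supportFn K u - supportFn K v| ≤ R * ‖u - v‖ := by
  have key : ∀ u v : E n, supportFn K u - supportFn K v ≤ R * ‖u - v‖ := fun u v => by
    obtain ⟨y, hy, h⟩ := exists_inner_eq_supportFn K u
    have h1 := inner_le_supportFn hy v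
    have h2 : inner ℝ (u - v) y ≤ ‖u - v‖ * ‖y‖ := real_inner_le_norm _ _
    have h3 := mul_le_mul_of_nonneg_left (hR y hy) (norm_nonneg (u - v))
    rw [inner_sub_left] at h2
    linarith
  rw [abs_le]
  have := key v u
  rw [norm_sub_rev] at this
  exact ⟨by linarith, key u v⟩

lemma continuous_supportFn (K : Body n) : Continuous (supportFn K) := by
  obtain ⟨R, hR, h⟩ := exists_norm_le K
  refine (LipschitzWith.of_dist_le_mul (K := ⟨R, hR.le⟩) fun u v => ?_).continuous
  rw [Real.dist_eq, dist_eq_norm]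
  exact abs_supportFn_sub_le h u v

lemma abs_supportFn_sub_le_dist (K L : Body n) (u : E n) :
    |supportFn K u - supportFn L u| ≤ dist K L * ‖u‖ := by
  have key : ∀ K L : Body n, supportFn K u - supportFn L u ≤ dist K L * ‖u‖ := fun K L => by
    obtain ⟨y, hy, h⟩ := exists_inner_eq_supportFn K u
    obtain ⟨z, hz, hyz⟩ := L.isCompact.exists_infDist_eq_dist L.nonempty y
    have h1 : dist y z ≤ dist K L := by
      rw [← hyz, ← ConvexBody.hausdorffDist_coe]
      exact Metric.infDist_le_hausdorffDist_of_mem hy ConvexBody.hausdorffEDist_ne_top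
    have h2 := inner_le_supportFn hz u
    have h3 : inner ℝ u (y - z) ≤ ‖u‖ * ‖y - z‖ := real_inner_le_norm _ _
    rw [inner_sub_right] at h3
    rw [dist_eq_norm] at h1
    nlinarith [norm_nonneg u]
  rw [abs_le]
  have := key L K
  rw [dist_comm] at this
  exact ⟨by linarith, key K L⟩

/-- The convex hull of the union of two convex bodies. -/
def hullBody (K L : Body n) : Body n where
  carrier := convexHull ℝ ((K : Set (E n)) ∪ L)
  convex' := convex_convexHull ℝ _
  isCompact' := by
    have h := ((isCompact_Icc (a := (0 : ℝ)) (b := 1)).prod (K.isCompact.prod L.isCompact)).image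
      (f := fun p : ℝ × E n × E n => (1 - p.1) • p.2.1 + p.1 • p.2.2) (by fun_prop)
    convert! h using 1
    rw [K.convex.convexHull_union L.convex K.nonempty L.nonempty]
    ext x
    simp only [mem_convexJoin, segment_eq_image, Set.mem_image, Set.mem_prod, Prod.exists]
    constructor
    · rintro ⟨a, ha, b, hb, t, ht, rfl⟩
      exact ⟨t, a, b, ⟨ht, ha, hb⟩, rfl⟩
    · rintro ⟨t, a, b, ⟨ht, ha, hb⟩, rfl⟩
      exact ⟨a, ha, b, hb, t, ht, rfl⟩
  nonempty' := (K.nonempty.mono Set.subset_union_left).convexHull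

lemma supportFn_hullBody (K L : Body n) (u : E n) :
    supportFn (hullBody K L) u = max (supportFn K u) (supportFn L u) := by
  have hsub := subset_convexHull ℝ ((K : Set (E n)) ∪ L)
  apply le_antisymm
  · refine supportFn_le fun y hy => ?_
    have hc : Convex ℝ {y : E n | inner ℝ u y ≤ max (supportFn K u) (supportFn L u)} :=
      convex_halfSpace_le (f := fun y : E n => inner ℝ u y)
        ⟨fun _ _ => inner_add_right _ _ _, fun _ _ => real_inner_smul_right _ _ _⟩ _
    refine convexHull_min ?_ hc hy
    rintro z (hz | hz)
    · exact (inner_le_supportFn hz u).trans (le_max_left _ _)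
    · exact (inner_le_supportFn hz u).trans (le_max_right _ _)
  · refine max_le ?_ ?_
    · exact supportFn_le fun y hy => inner_le_supportFn (K := hullBody K L) (hsub (Or.inl hy)) u
    · exact supportFn_le fun y hy => inner_le_supportFn (K := hullBody K L) (hsub (Or.inr hy)) u

/-- The segment joining the origin to `v`, as a convex body. -/
def segBody (v : E n) : Body n where
  carrier := segment ℝ 0 v
  convex' := convex_segment 0 v
  isCompact' := by
    rw [← convexHull_pair]
    exact (Set.toFinite {(0 : E n), v}).isCompact_convexHull ℝ
  nonempty' := ⟨0, left_mem_segment ℝ 0 v⟩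

lemma mem_segBody {v x : E n} : x ∈ segBody v ↔ ∃ t : ℝ, 0 ≤ t ∧ t ≤ 1 ∧ x = t • v := by
  change x ∈ segment ℝ 0 v ↔ _
  rw [segment_eq_image]
  constructor
  · rintro ⟨t, ht, rfl⟩
    exact ⟨t, ht.1, ht.2, by simp⟩
  · rintro ⟨t, h0, h1, rfl⟩
    exact ⟨t, ⟨h0, h1⟩, by simp⟩

lemma supportFn_segBody (v u : E n) : supportFn (segBody v) u = max 0 (inner ℝ u v) := by
  apply le_antisymm
  · refine supportFn_le fun y hy => ?_
    obtain ⟨t, h0, h1, rfl⟩ := mem_segBody.1 hy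
    rw [real_inner_smul_right]
    rcases le_total 0 (inner ℝ u v) with h | h
    · exact le_max_of_le_right (by nlinarith)
    · exact le_max_of_le_left (by nlinarith)
  · refine max_le ?_ ?_
    · simpa using inner_le_supportFn (mem_segBody.2 ⟨0, le_rfl, zero_le_one, rfl⟩ :
        (0 : ℝ) • v ∈ segBody v) u
    · simpa using inner_le_supportFn (mem_segBody.2 ⟨1, zero_le_one, le_rfl, rfl⟩ :
        (1 : ℝ) • v ∈ segBody v) u

lemma add_smul_body (K : Body n) {s t : ℝ} (hs : 0 ≤ s) (ht : 0 ≤ t) :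
    (s + t) • K = s • K + t • K :=
  eq_of_supportFn_eq fun u => by
    rw [supportFn_body_add, supportFn_body_smul _ hs, supportFn_body_smul _ ht,
      supportFn_body_smul _ (add_nonneg hs ht), add_mul]

lemma zero_smul_body (K : Body n) : (0 : ℝ) • K = 0 :=
  eq_of_supportFn_eq fun u => by
    rw [supportFn_body_smul _ le_rfl, supportFn_zero_body, zero_mul]

/-- The support function, restricted to the sphere, as a continuous function. -/
def suppC (K : Body n) : C(Sph n, ℝ) :=
  ⟨fun u => supportFn K u, (continuous_supportFn K).comp continuous_subtype_val⟩

@[simp] lemma suppC_apply (K : Body n) (u : Sph n) : suppC K u = supportFn K u := rfl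

lemma suppC_add (K L : Body n) : suppC (K + L) = suppC K + suppC L := by
  ext u; simp [supportFn_body_add]

lemma suppC_smul (K : Body n) {t : ℝ} (ht : 0 ≤ t) : suppC (t • K) = t • suppC K := by
  ext u; simp [supportFn_body_smul K ht]

lemma suppC_unitBall : suppC (unitBall n) = 1 := by
  ext u; simp [supportFn_unitBall]

lemma suppC_injective : Function.Injective (suppC (n := n)) := fun _ _ h =>
  eq_of_supportFn_eq fun u => DFunLike.congr_fun h u

end Support

/-! ### Gradient images of convex functions -/

section Gradient

variable {n : ℕ}

/-- The `i`-th standard basis vector. -/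
abbrev stdVec (i : Fin n) : E n := EuclideanSpace.basisFun (Fin n) ℝ i

/-- The Riesz identification of a linear form with a vector, as a real-linear map. -/
def rieszVec : (E n →L[ℝ] ℝ) →L[ℝ] E n :=
  ∑ i : Fin n, (ContinuousLinearMap.apply ℝ ℝ (stdVec i)).smulRight (stdVec i)

lemma inner_rieszVec (f : E n →L[ℝ] ℝ) (y : E n) : inner ℝ y (rieszVec f) = f y := by
  conv_rhs => rw [← (EuclideanSpace.basisFun (Fin n) ℝ).sum_repr' y]
  simp only [rieszVec, sum_apply, ContinuousLinearMap.smulRight_apply,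
    ContinuousLinearMap.apply_apply, inner_sum, inner_smul_right, map_sum, map_smul, smul_eq_mul]
  refine Finset.sum_congr rfl fun i _ => ?_
  rw [mul_comm, real_inner_comm]

/-- The gradient of `φ`. -/
def gradVec (φ : E n → ℝ) (x : E n) : E n := rieszVec (fderiv ℝ φ x)

/-- The second derivative of `φ`, as an endomorphism. -/
def hessMap (φ : E n → ℝ) (x : E n) : E n →L[ℝ] E n := rieszVec ∘L fderiv ℝ (fderiv ℝ φ) x

/-- The matrix of second partial derivatives of `φ`. -/
def hessMat (φ : E n → ℝ) (x : E n) : Matrix (Fin n) (Fin n) ℝ :=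
  Matrix.of fun i j => fderiv ℝ (fderiv ℝ φ) x (stdVec j) (stdVec i)

lemma inner_gradVec (φ : E n → ℝ) (x y : E n) : inner ℝ y (gradVec φ x) = fderiv ℝ φ x y :=
  inner_rieszVec _ _

lemma inner_hessMap (φ : E n → ℝ) (x y z : E n) :
    inner ℝ y (hessMap φ x z) = fderiv ℝ (fderiv ℝ φ) x z y :=
  inner_rieszVec _ _

lemma det_hessMap (φ : E n → ℝ) (x : E n) : (hessMap φ x).det = (hessMat φ x).det := by
  rw [ContinuousLinearMap.det, ← LinearMap.det_toMatrix (EuclideanSpace.basisFun (Fin n) ℝ).toBasis]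
  congr 1
  ext i j
  rw [LinearMap.toMatrix_apply]
  simp only [OrthonormalBasis.coe_toBasis, OrthonormalBasis.coe_toBasis_repr_apply,
    OrthonormalBasis.repr_apply_apply]
  exact inner_hessMap _ _ _ _

lemma hasFDerivAt_gradVec {φ : E n → ℝ} (hφ : ContDiff ℝ 2 φ) (x : E n) :
    HasFDerivAt (gradVec φ) (hessMap φ x) x := by
  have h : Differentiable ℝ (fderiv ℝ φ) :=
    (hφ.fderiv_right (m := 1) (by norm_num)).differentiable (by norm_num)
  exact rieszVec.hasFDerivAt.comp x (h x).hasFDerivAt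

lemma continuous_hessMap {φ : E n → ℝ} (hφ : ContDiff ℝ 2 φ) : Continuous (hessMap φ) := by
  have h : Continuous (fderiv ℝ (fderiv ℝ φ)) :=
    (hφ.fderiv_right (m := 1) (by norm_num)).continuous_fderiv (by norm_num)
  exact continuous_const.clm_comp h

lemma continuous_det_hessMap {φ : E n → ℝ} (hφ : ContDiff ℝ 2 φ) :
    Continuous fun x => (hessMap φ x).det :=
  ContinuousLinearMap.continuous_det.comp (continuous_hessMap hφ)

lemma fderiv_apply_le {φ : E n → ℝ} {x z : E n} {c : ℝ} (hφ : DifferentiableAt ℝ φ x)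
    (h : ∀ t : ℝ, 0 < t → t ≤ 1 → φ (x + t • z) ≤ φ x + t * c) : fderiv ℝ φ x z ≤ c := by
  have h1 := (hφ.hasFDerivAt.hasLineDerivAt z).tendsto_slope_zero_right
  refine le_of_tendsto h1 ?_
  filter_upwards [Ioc_mem_nhdsGT (zero_lt_one' ℝ)] with t ht
  rw [smul_eq_mul, inv_mul_le_iff₀ ht.1]
  linarith [h t ht.1 ht.2]

lemma fderiv_apply_le_sub {φ : E n → ℝ} (hφ : ContDiff ℝ 2 φ) (hc : ConvexOn ℝ Set.univ φ)
    (x z : E n) : fderiv ℝ φ x z ≤ φ (x + z) - φ x := by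
  refine fderiv_apply_le (hφ.differentiable (by norm_num) x) fun t h0 h1 => ?_
  have := hc.2 (Set.mem_univ x) (Set.mem_univ (x + z)) (sub_nonneg.2 h1) h0.le (by ring)
  rw [show (1 - t) • x + t • (x + z) = x + t • z by module] at this
  simp only [smul_eq_mul] at this
  linarith

lemma fderiv_mono {φ : E n → ℝ} (hφ : ContDiff ℝ 2 φ) (hc : ConvexOn ℝ Set.univ φ)
    (x z : E n) : fderiv ℝ φ x z ≤ fderiv ℝ φ (x + z) z := by
  have h1 := fderiv_apply_le_sub hφ hc x z
  have h2 := fderiv_apply_le_sub hφ hc (x + z) (-z)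
  rw [map_neg, add_neg_cancel_right] at h2
  linarith

lemma hasDerivAt_fderiv_line {φ : E n → ℝ} (hφ : ContDiff ℝ 2 φ) (x z : E n) :
    HasDerivAt (fun t : ℝ => fderiv ℝ φ (x + t • z) z) (fderiv ℝ (fderiv ℝ φ) x z z) 0 := by
  have h : Differentiable ℝ (fderiv ℝ φ) :=
    (hφ.fderiv_right (m := 1) (by norm_num)).differentiable (by norm_num)
  have h1 : HasDerivAt (fun t : ℝ => fderiv ℝ φ (x + t • z)) (fderiv ℝ (fderiv ℝ φ) x z) 0 :=
    (h x).hasFDerivAt.hasLineDerivAt z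
  exact h1.clm_apply (hasDerivAt_const _ _) |>.congr_deriv (by simp)

lemma monotone_fderiv_line {φ : E n → ℝ} (hφ : ContDiff ℝ 2 φ) (hc : ConvexOn ℝ Set.univ φ)
    (x z : E n) : Monotone fun t : ℝ => fderiv ℝ φ (x + t • z) z := by
  intro s t hst
  rcases hst.eq_or_lt with rfl | hst
  · exact le_rfl
  have h := fderiv_mono hφ hc (x + s • z) ((t - s) • z)
  rw [show x + s • z + (t - s) • z = x + t • z by module, map_smul, map_smul, smul_eq_mul,
    smul_eq_mul] at h
  exact le_of_mul_le_mul_left h (sub_pos.2 hst)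

lemma hess_self_nonneg {φ : E n → ℝ} (hφ : ContDiff ℝ 2 φ) (hc : ConvexOn ℝ Set.univ φ)
    (x z : E n) : 0 ≤ fderiv ℝ (fderiv ℝ φ) x z z := by
  rw [← (hasDerivAt_fderiv_line hφ x z).deriv]
  exact (monotone_fderiv_line hφ hc x z).deriv_nonneg

lemma hess_symm {φ : E n → ℝ} (hφ : ContDiff ℝ 2 φ) (x z w : E n) :
    fderiv ℝ (fderiv ℝ φ) x z w = fderiv ℝ (fderiv ℝ φ) x w z :=
  (hφ.contDiffAt.isSymmSndFDerivAt (by simp)) z w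

lemma det_hessMat_nonneg {φ : E n → ℝ} (hφ : ContDiff ℝ 2 φ) (hc : ConvexOn ℝ Set.univ φ)
    (x : E n) : 0 ≤ (hessMat φ x).det := by
  apply Matrix.PosSemidef.det_nonneg
  refine Matrix.PosSemidef.of_dotProduct_mulVec_nonneg ?_ fun v => ?_
  · ext i j
    simpa [hessMat] using hess_symm hφ x _ _
  · have := hess_self_nonneg hφ hc x (∑ i, v i • stdVec i)
    refine this.trans_eq ?_
    simp only [map_sum, map_smul, sum_apply, smul_apply,
      smul_eq_mul, dotProduct, Matrix.mulVec, hessMat, Matrix.of_apply, star_trivial,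
      Finset.mul_sum]
    refine Finset.sum_congr rfl fun i _ => Finset.sum_congr rfl fun j _ => ?_
    ring

/-- A positive semidefinite Hessian is degenerate as soon as it vanishes on some direction. -/
lemma hessMap_eq_zero {φ : E n → ℝ} (hφ : ContDiff ℝ 2 φ) (hc : ConvexOn ℝ Set.univ φ)
    {x z : E n} (h : fderiv ℝ (fderiv ℝ φ) x z z = 0) : hessMap φ x z = 0 := by
  set w := hessMap φ x z with hw
  set D := fderiv ℝ (fderiv ℝ φ) x with hD
  have hzw : D z w = ‖w‖ ^ 2 := by
    rw [← inner_hessMap, ← hw, real_inner_self_eq_norm_sq]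
  by_contra hne
  have hpos : 0 < ‖w‖ ^ 2 := by positivity
  have hww : 0 ≤ D w w := hess_self_nonneg hφ hc x w
  -- for small `s > 0` the quadratic form would be negative at `z - s w`
  set s : ℝ := ‖w‖ ^ 2 / (D w w + 1) with hs
  have hs0 : 0 < s := by positivity
  have key := hess_self_nonneg hφ hc x (z - s • w)
  rw [← hD] at key
  simp only [map_sub, map_smul, sub_apply, smul_apply,
    smul_eq_mul] at key
  rw [h, hess_symm hφ x w z, ← hD, hzw] at key
  have hs1 : s * (D w w + 1) = ‖w‖ ^ 2 := by rw [hs]; field_simp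
  nlinarith

/-- On the set where its Hessian is nondegenerate, the gradient of a convex function is
injective: if it takes equal values at `x` and `y`, it is constant along the segment between. -/
lemma injOn_gradVec {φ : E n → ℝ} (hφ : ContDiff ℝ 2 φ) (hc : ConvexOn ℝ Set.univ φ) :
    Set.InjOn (gradVec φ) {x | (hessMap φ x).det ≠ 0} := by
  intro x hx y _ hxy
  by_contra hne
  set z := y - x with hz
  have hz0 : z ≠ 0 := sub_ne_zero.2 (Ne.symm hne)
  have hmono := monotone_fderiv_line hφ hc x z
  have h01 : fderiv ℝ φ (x + (1 : ℝ) • z) z = fderiv ℝ φ (x + (0 : ℝ) • z) z := by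
    rw [one_smul, zero_smul, add_zero, hz, add_sub_cancel, ← inner_gradVec, ← inner_gradVec, hxy]
  have hder := (hasDerivAt_fderiv_line hφ x z).hasDerivWithinAt (s := Set.Icc 0 1)
  have hconst : HasDerivWithinAt (fun t : ℝ => fderiv ℝ φ (x + t • z) z) 0 (Set.Icc 0 1) 0 := by
    refine (hasDerivWithinAt_const (0 : ℝ) (Set.Icc 0 1)
      (fderiv ℝ φ (x + (0 : ℝ) • z) z)).congr_of_mem (fun t ht => ?_) (by simp)
    exact le_antisymm ((hmono ht.2).trans_eq h01) (hmono ht.1)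
  have h0 : fderiv ℝ (fderiv ℝ φ) x z z = 0 :=
    UniqueDiffWithinAt.eq_deriv _ (uniqueDiffOn_Icc (zero_lt_one' ℝ) 0 (by simp)) hder hconst
  refine hx ?_
  have h2 := hessMap_eq_zero hφ hc h0
  by_contra hdet
  exact hz0 ((LinearMap.equivOfDetNeZero _ hdet).injective (by simpa using h2))

/-- The area formula for the gradient of a convex function. It applies on the set where the Hessian is
nondegenerate; the image of the complement is a null set by Sard's lemma. -/
lemma volume_range_gradVec {φ : E n → ℝ} (hφ : ContDiff ℝ 2 φ) (hc : ConvexOn ℝ Set.univ φ) :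
    volume (Set.range (gradVec φ)) = ∫⁻ x, ENNReal.ofReal (hessMat φ x).det := by
  set U := {x : E n | (hessMap φ x).det ≠ 0} with hU
  have hUm : MeasurableSet U :=
    (measurableSet_singleton (0 : ℝ)).compl.preimage (continuous_det_hessMap hφ).measurable
  have h1 := lintegral_abs_det_fderiv_eq_addHaar_image volume hUm
    (fun x _ => (hasFDerivAt_gradVec hφ x).hasFDerivWithinAt) (injOn_gradVec hφ hc)
  have h2 := addHaar_image_eq_zero_of_det_fderivWithin_eq_zero volume (s := Uᶜ)
    (fun x _ => (hasFDerivAt_gradVec hφ x).hasFDerivWithinAt)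
    (fun x hx => by simpa [hU] using hx)
  have h3 : volume (Set.range (gradVec φ)) = volume (gradVec φ '' U) := by
    rw [← Set.image_univ, ← Set.union_compl_self U, Set.image_union]
    exact le_antisymm ((measure_union_le _ _).trans_eq (by rw [h2, add_zero]))
      (measure_mono Set.subset_union_left)
  rw [h3, ← h1, ← lintegral_add_compl (fun x => ENNReal.ofReal (hessMat φ x).det) hUm]
  have h4 : ∫⁻ x in Uᶜ, ENNReal.ofReal (hessMat φ x).det = 0 := by
    rw [setLIntegral_congr_fun (g := fun _ => 0) hUm.compl]
    · simp
    · intro x hx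
      have : (hessMap φ x).det = 0 := by simpa [hU] using hx
      simp [← det_hessMap, this]
  rw [h4, add_zero]
  refine lintegral_congr fun x => ?_
  rw [det_hessMap, abs_of_nonneg (det_hessMat_nonneg hφ hc x)]

/-- The gradient of a convex function that differs from a support function by a bounded amount
takes values in the body and attains all its interior points. -/
lemma volume_eq_lintegral_det {φ : E n → ℝ} (hφ : ContDiff ℝ 2 φ) (hc : ConvexOn ℝ Set.univ φ)
    {K : Body n} {C : ℝ} (hlow : ∀ x, supportFn K x - C ≤ φ x)
    (hup : ∀ x z, φ (x + z) ≤ φ x + supportFn K z) :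
    volume (K : Set (E n)) = ∫⁻ x, ENNReal.ofReal (hessMat φ x).det := by
  rw [← volume_range_gradVec hφ hc]
  have hd : Differentiable ℝ φ := hφ.differentiable (by norm_num)
  have hsub : Set.range (gradVec φ) ⊆ K := by
    rintro _ ⟨x, rfl⟩
    refine mem_of_forall_inner_le fun u => ?_
    rw [inner_gradVec]
    refine fderiv_apply_le (hd x) fun t h0 _ => ?_
    rw [← supportFn_smul K h0.le]
    exact hup x (t • u)
  have hsup : interior (K : Set (E n)) ⊆ Set.range (gradVec φ) := by
    intro p hp
    -- `φ - ⟨·, p⟩` is coercive for interior `p`; at its minimum the gradient of `φ` is `p`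
    obtain ⟨δ, hδ, hball⟩ := Metric.nhds_basis_closedBall.mem_iff.1 (mem_interior_iff_mem_nhds.1 hp)
    have hcoer : ∀ x, δ * ‖x‖ - C ≤ φ x - inner ℝ x p := fun x => by
      by_cases hx : x = 0
      · have := hlow 0
        rw [supportFn_zero] at this
        simpa [hx] using this
      have h0 : ‖x‖ ≠ 0 := norm_ne_zero_iff.2 hx
      have hmem : p + (δ * ‖x‖⁻¹) • x ∈ K := hball (by
        rw [Metric.mem_closedBall, dist_eq_norm, add_sub_cancel_left, norm_smul, norm_mul,
          norm_inv, norm_norm, Real.norm_of_nonneg hδ.le, mul_assoc, inv_mul_cancel₀ h0, mul_one])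
      have h1 := inner_le_supportFn hmem x
      rw [inner_add_right, real_inner_smul_right, real_inner_self_eq_norm_sq,
        show δ * ‖x‖⁻¹ * ‖x‖ ^ 2 = δ * ‖x‖ by field_simp] at h1
      linarith [hlow x]
    have hcont : Continuous fun x => φ x - inner ℝ x p := by
      have := hφ.continuous
      fun_prop
    have hlim : Filter.Tendsto (fun x => φ x - inner ℝ x p) (Filter.cocompact (E n)) Filter.atTop := by
      refine Filter.tendsto_atTop_mono hcoer ?_
      exact Filter.tendsto_atTop_add_const_right _ _
        ((tendsto_norm_cocompact_atTop (E := E n)).const_mul_atTop hδ)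
    obtain ⟨x, hx⟩ := hcont.exists_forall_le hlim
    refine ⟨x, ext_inner_left ℝ fun y => ?_⟩
    rw [inner_gradVec]
    have hmin : IsLocalMin (fun x => φ x - inner ℝ x p) x := Filter.Eventually.of_forall hx
    have hder : HasFDerivAt (fun x => φ x - inner ℝ x p)
        (fderiv ℝ φ x - (innerSL ℝ p)) x := by
      refine (hd x).hasFDerivAt.sub ?_
      simpa [real_inner_comm] using (innerSL ℝ p).hasFDerivAt (x := x)
    have h0 := hmin.hasFDerivAt_eq_zero hder
    have := DFunLike.congr_fun h0 y
    simp only [sub_apply, innerSL_apply_apply, zero_apply] at this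
    rw [real_inner_comm]
    linarith
  refine le_antisymm ?_ (measure_mono hsub)
  calc volume (K : Set (E n)) ≤ volume (interior (K : Set (E n)) ∪ frontier (K : Set (E n))) :=
        measure_mono (by
          rw [← closure_eq_interior_union_frontier]
          exact subset_closure)
    _ ≤ volume (interior (K : Set (E n))) + volume (frontier (K : Set (E n))) := measure_union_le _ _
    _ = volume (interior (K : Set (E n))) := by rw [K.convex.addHaar_frontier volume, add_zero]
    _ ≤ _ := measure_mono hsup

end Gradient

/-! ### The volume of Minkowski combinations is a polynomial -/

section Smoothing

variable {n : ℕ}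

/-- A smooth, compactly supported probability density. -/
def kernel (n : ℕ) : E n → ℝ := (default : ContDiffBump (0 : E n)).normed volume

/-- The support function of `K`, mollified by `kernel`. -/
def smoothed (K : Body n) : E n → ℝ :=
  convolution (kernel n) (supportFn K) (ContinuousLinearMap.lsmul ℝ ℝ) volume

lemma smoothed_apply (K : Body n) (x : E n) :
    smoothed K x = ∫ t, kernel n t * supportFn K (x - t) := rfl

lemma kernel_nonneg (x : E n) : 0 ≤ kernel n x := ContDiffBump.nonneg_normed _ _

lemma integral_kernel : ∫ x, kernel n x = 1 := ContDiffBump.integral_normed _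

lemma continuous_kernel : Continuous (kernel n) := ContDiffBump.continuous_normed _

lemma hasCompactSupport_kernel : HasCompactSupport (kernel n) :=
  ContDiffBump.hasCompactSupport_normed _

/-- The default bump function has outer radius `2`. -/
lemma kernel_eq_zero {x : E n} (hx : 2 ≤ ‖x‖) : kernel n x = 0 := by
  have h : x ∉ Function.support ((default : ContDiffBump (0 : E n)).normed volume) := by
    rw [ContDiffBump.support_normed_eq]
    have : (default : ContDiffBump (0 : E n)).rOut = 2 := rfl
    simpa [this] using hx
  exact Function.notMem_support.1 h

lemma integrable_kernel_mul {f : E n → ℝ} (hf : Continuous f) :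
    Integrable fun t => kernel n t * f t :=
  (continuous_kernel.mul hf).integrable_of_hasCompactSupport hasCompactSupport_kernel.mul_right

lemma integrable_kernel_supportFn (K : Body n) (x : E n) :
    Integrable fun t => kernel n t * supportFn K (x - t) :=
  integrable_kernel_mul ((continuous_supportFn K).comp (by fun_prop))

lemma contDiff_smoothed (K : Body n) : ContDiff ℝ 2 (smoothed K) :=
  hasCompactSupport_kernel.contDiff_convolution_left _ (ContDiffBump.contDiff_normed _)
    (continuous_supportFn K).locallyIntegrable

lemma convexOn_smoothed (K : Body n) : ConvexOn ℝ Set.univ (smoothed K) := by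
  refine ⟨convex_univ, fun x _ y _ a b ha hb hab => ?_⟩
  simp only [smoothed_apply, smul_eq_mul, ← integral_const_mul]
  rw [← integral_add ((integrable_kernel_supportFn K x).const_mul a)
    ((integrable_kernel_supportFn K y).const_mul b)]
  refine integral_mono (integrable_kernel_supportFn K _)
    (((integrable_kernel_supportFn K x).const_mul a).add
    ((integrable_kernel_supportFn K y).const_mul b)) fun t => ?_
  have h := (convexOn_supportFn K).2 (Set.mem_univ (x - t)) (Set.mem_univ (y - t)) ha hb hab
  rw [show a • (x - t) + b • (y - t) = a • x + b • y - t by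
    rw [show a • x + b • y - t = a • x + b • y - (1 : ℝ) • t by simp, ← hab]; module] at h
  have := mul_le_mul_of_nonneg_left h (kernel_nonneg t)
  simp only [smul_eq_mul] at this ⊢
  linarith

lemma smoothed_add_le (K : Body n) (x z : E n) :
    smoothed K (x + z) ≤ smoothed K x + supportFn K z := by
  have h : supportFn K z = ∫ t, kernel n t * supportFn K z := by
    rw [integral_mul_const, integral_kernel, one_mul]
  rw [smoothed_apply, smoothed_apply, h, ← integral_add (integrable_kernel_supportFn K x)
    (integrable_kernel_mul continuous_const)]
  refine integral_mono (integrable_kernel_supportFn K _) ((integrable_kernel_supportFn K x).add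
    (integrable_kernel_mul continuous_const)) fun t => ?_
  have := mul_le_mul_of_nonneg_left (supportFn_add_le K (x - t) z) (kernel_nonneg t)
  rw [show x - t + z = x + z - t by abel] at this
  simp only
  linarith

/-- Mollification moves a support function, which is Lipschitz, by a bounded amount. -/
lemma exists_sub_le_smoothed (K : Body n) : ∃ C, ∀ x, supportFn K x - C ≤ smoothed K x := by
  obtain ⟨R, hR, h⟩ := exists_norm_le K
  refine ⟨R * 2, fun x => ?_⟩
  have h1 : supportFn K x - R * 2 = ∫ t, kernel n t * (supportFn K x - R * 2) := by
    rw [integral_mul_const, integral_kernel, one_mul]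
  rw [h1, smoothed_apply]
  refine integral_mono (integrable_kernel_mul continuous_const)
    (integrable_kernel_supportFn K x) fun t => ?_
  by_cases ht : 2 ≤ ‖t‖
  · simp [kernel_eq_zero ht]
  · refine mul_le_mul_of_nonneg_left ?_ (kernel_nonneg t)
    have h2 := (abs_le.1 (abs_supportFn_sub_le h x (x - t))).2
    rw [sub_sub_cancel] at h2
    nlinarith

lemma volume_eq_lintegral_smoothed (K : Body n) :
    volume (K : Set (E n)) = ∫⁻ x, ENNReal.ofReal (hessMat (smoothed K) x).det := by
  obtain ⟨C, hC⟩ := exists_sub_le_smoothed K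
  exact volume_eq_lintegral_det (contDiff_smoothed K) (convexOn_smoothed K) hC (smoothed_add_le K)

lemma continuous_det_hessMat_smoothed (K : Body n) :
    Continuous fun x => (hessMat (smoothed K) x).det := by
  simp only [← det_hessMap]
  exact continuous_det_hessMap (contDiff_smoothed K)

lemma integrable_det_smoothed (K : Body n) :
    Integrable fun x => (hessMat (smoothed K) x).det := by
  refine ⟨(continuous_det_hessMat_smoothed K).aestronglyMeasurable, ?_⟩
  rw [hasFiniteIntegral_iff_ofReal (Filter.Eventually.of_forall
    (det_hessMat_nonneg (contDiff_smoothed K) (convexOn_smoothed K))),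
    ← volume_eq_lintegral_smoothed]
  exact K.isCompact.measure_lt_top

/-- The volume of a convex body is the integral of the Monge-Ampère density of its smoothed
support function. -/
lemma volume_real_eq_integral (K : Body n) :
    (volume : Measure (E n)).real (K : Set (E n)) = ∫ x, (hessMat (smoothed K) x).det := by
  rw [integral_eq_lintegral_of_nonneg_ae (Filter.Eventually.of_forall
    (det_hessMat_nonneg (contDiff_smoothed K) (convexOn_smoothed K)))
    (continuous_det_hessMat_smoothed K).aestronglyMeasurable, ← volume_eq_lintegral_smoothed]
  rfl

lemma smoothed_sum {ι : Type*} [Fintype ι] (K : ι → Body n) {l : ι → ℝ} (hl : ∀ i, 0 ≤ l i) :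
    smoothed (∑ i, l i • K i) = fun x => ∑ i, l i * smoothed (K i) x := by
  ext x
  simp only [smoothed_apply, ← integral_const_mul]
  rw [← integral_finsetSum _ fun i _ => (integrable_kernel_supportFn (K i) x).const_mul (l i)]
  refine integral_congr_ae (Filter.Eventually.of_forall fun t => ?_)
  simp only [supportFn_body_sum _ K l (fun i _ => hl i), Finset.mul_sum]
  exact Finset.sum_congr rfl fun i _ => by ring

lemma hessMat_sum {ι : Type*} [Fintype ι] (K : ι → Body n) {l : ι → ℝ} (hl : ∀ i, 0 ≤ l i)
    (x : E n) :
    hessMat (smoothed (∑ i, l i • K i)) x = ∑ i, l i • hessMat (smoothed (K i)) x := by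
  have hd : ∀ i, Differentiable ℝ (smoothed (K i)) := fun i =>
    (contDiff_smoothed (K i)).differentiable (by norm_num)
  have hd2 : ∀ i, Differentiable ℝ (fderiv ℝ (smoothed (K i))) := fun i =>
    ((contDiff_smoothed (K i)).fderiv_right (m := 1) (by norm_num)).differentiable (by norm_num)
  have h1 : fderiv ℝ (smoothed (∑ i, l i • K i)) =
      fun x => ∑ i, l i • fderiv ℝ (smoothed (K i)) x := by
    ext1 x
    rw [smoothed_sum K hl]
    exact (HasFDerivAt.fun_sum fun i _ => ((hd i x).hasFDerivAt.const_smul (l i))).fderiv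
  have h2 : fderiv ℝ (fderiv ℝ (smoothed (∑ i, l i • K i))) x =
      ∑ i, l i • fderiv ℝ (fderiv ℝ (smoothed (K i))) x := by
    rw [h1]
    exact (HasFDerivAt.fun_sum fun i _ => ((hd2 i x).hasFDerivAt.const_smul (l i))).fderiv
  ext a b
  simp [hessMat, h2, Matrix.sum_apply]

end Smoothing

section Polynomial

variable {n : ℕ} {ι : Type*} [Fintype ι]

/-- The determinant of a linear combination of matrices, as a polynomial in the coefficients. -/
def detPoly (M : ι → Matrix (Fin n) (Fin n) ℝ) : MvPolynomial ι ℝ :=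
  (Matrix.of fun a b => ∑ i, MvPolynomial.X i * MvPolynomial.C (M i a b)).det

lemma eval_detPoly (M : ι → Matrix (Fin n) (Fin n) ℝ) (l : ι → ℝ) :
    MvPolynomial.eval l (detPoly M) = (∑ i, l i • M i).det := by
  rw [detPoly, RingHom.map_det]
  congr 1
  ext a b
  simp [Matrix.sum_apply]

lemma isHomogeneous_detPoly (M : ι → Matrix (Fin n) (Fin n) ℝ) :
    (detPoly M).IsHomogeneous n := by
  rw [detPoly, Matrix.det_apply']
  refine MvPolynomial.IsHomogeneous.sum _ _ _ fun σ _ => ?_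
  convert! MvPolynomial.IsHomogeneous.mul (m := 0) (n := n) ?_ ?_ using 1
  · exact (zero_add n).symm
  · rw [show ((Equiv.Perm.sign σ : ℤ) : MvPolynomial ι ℝ) =
      MvPolynomial.C ((Equiv.Perm.sign σ : ℤ) : ℝ) by simp]
    exact MvPolynomial.isHomogeneous_C _ _
  · have := MvPolynomial.IsHomogeneous.prod (Finset.univ : Finset (Fin n))
      (fun a => (Matrix.of fun a b => ∑ i, MvPolynomial.X i * MvPolynomial.C (M i a b)) (σ a) a)
      (fun _ => 1) (fun a _ => ?_)
    · simpa using this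
    · refine MvPolynomial.IsHomogeneous.sum _ _ _ fun i _ => ?_
      exact (MvPolynomial.isHomogeneous_X ℝ i).mul (MvPolynomial.isHomogeneous_C _ _)

/-- Interpolation on the grid `{0, …, m}^ι`: each coefficient of a homogeneous polynomial of degree
`m` is a fixed linear combination of its values at nonnegative points. -/
lemma exists_coeff_eq_sum_eval [DecidableEq ι] (m : ℕ) (d : ι →₀ ℕ) :
    ∃ c : (ι → Fin (m + 1)) → ℝ, ∀ P : MvPolynomial ι ℝ, P.IsHomogeneous m →
      P.coeff d = ∑ a, c a * MvPolynomial.eval (fun i => ((a i : ℕ) : ℝ)) P := by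
  let W := MvPolynomial.homogeneousSubmodule ι ℝ m
  let L : (ι → Fin (m + 1)) → W →ₗ[ℝ] ℝ := fun a =>
    (MvPolynomial.aeval (R := ℝ) (fun i => ((a i : ℕ) : ℝ))).toLinearMap ∘ₗ W.subtype
  let Kd : W →ₗ[ℝ] ℝ := MvPolynomial.lcoeff ℝ d ∘ₗ W.subtype
  have hmem : Kd ∈ Submodule.span ℝ (Set.range L) := by
    refine mem_span_of_iInf_ker_le_ker fun P hP => ?_
    have h0 : (P : MvPolynomial ι ℝ) = 0 := by
      refine MvPolynomial.eq_zero_of_eval_zero_at_prod_finset _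
        (fun _ => (Finset.univ : Finset (Fin (m + 1))).image fun k : Fin (m + 1) => ((k : ℕ) : ℝ)) (fun i => ?_) ?_
      · rw [Finset.card_image_of_injective _ fun a b hab => Fin.ext (by exact_mod_cast hab)]
        rw [Finset.card_univ, Fintype.card_fin, Nat.lt_succ_iff]
        exact (MvPolynomial.degreeOf_le_totalDegree _ i).trans
          (MvPolynomial.IsHomogeneous.totalDegree_le P.2)
      · intro x hx
        simp only [Finset.mem_image, Finset.mem_univ, true_and] at hx
        choose a ha using hx
        have := (Submodule.mem_iInf _).1 hP a
        simp only [L, LinearMap.mem_ker, LinearMap.comp_apply, Submodule.subtype_apply,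
          AlgHom.toLinearMap_apply, MvPolynomial.aeval_eq_eval] at this
        rw [← this]
        congr 2
        ext i
        exact (ha i).symm
    have : P = 0 := Subtype.ext h0
    simp [this]
  obtain ⟨c, hc⟩ := (Submodule.mem_span_range_iff_exists_fun ℝ).1 hmem
  refine ⟨c, fun P hP => ?_⟩
  have := LinearMap.congr_fun hc ⟨P, hP⟩
  simpa [Kd, L, MvPolynomial.aeval_eq_eval, LinearMap.sum_apply] using this.symm

/-- **Minkowski's theorem** on mixed volumes: for nonnegative coefficients, the volume of a
Minkowski combination of `n`-dimensional convex bodies is a homogeneous polynomial of degree `n`. -/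
theorem exists_volume_polynomial (K : ι → Body n) :
    ∃ P : MvPolynomial ι ℝ, P.IsHomogeneous n ∧ ∀ l : ι → ℝ, (∀ i, 0 ≤ l i) →
      (volume : Measure (E n)).real ((∑ i, l i • K i : Body n) : Set (E n)) =
        MvPolynomial.eval l P := by
  classical
  set p : E n → MvPolynomial ι ℝ := fun x => detPoly fun i => hessMat (smoothed (K i)) x with hp
  have hhom : ∀ x, (p x).IsHomogeneous n := fun x => isHomogeneous_detPoly _
  have heval : ∀ l : ι → ℝ, (∀ i, 0 ≤ l i) → ∀ x,
      MvPolynomial.eval l (p x) = (hessMat (smoothed (∑ i, l i • K i)) x).det := fun l hl x => by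
    rw [hp, eval_detPoly, hessMat_sum K hl]
  have hint : ∀ l : ι → ℝ, (∀ i, 0 ≤ l i) → Integrable fun x => MvPolynomial.eval l (p x) :=
    fun l hl => by
      simp only [heval l hl]
      exact integrable_det_smoothed _
  have hcoeff : ∀ d, Integrable fun x => (p x).coeff d := fun d => by
    obtain ⟨c, hc⟩ := exists_coeff_eq_sum_eval (ι := ι) n d
    simp only [hc _ (hhom _)]
    exact integrable_finsetSum _ fun a _ => (hint _ fun i => Nat.cast_nonneg _).const_mul _
  let D : Finset (ι →₀ ℕ) := Finset.finsuppAntidiag Finset.univ n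
  have hD : ∀ x, (p x).support ⊆ D := fun x d hd => by
    rw [Finset.mem_finsuppAntidiag]
    refine ⟨?_, Finset.subset_univ _⟩
    have := hhom x (MvPolynomial.mem_support_iff.1 hd)
    rw [← this, Finsupp.weight_apply, Finsupp.sum_fintype _ _ (by simp)]
    simp
  refine ⟨∑ d ∈ D, MvPolynomial.monomial d (∫ x, (p x).coeff d), ?_, fun l hl => ?_⟩
  · refine MvPolynomial.IsHomogeneous.sum _ _ _ fun d hd => ?_
    refine MvPolynomial.isHomogeneous_monomial _ ?_
    rw [Finset.mem_finsuppAntidiag] at hd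
    rw [← hd.1, Finsupp.degree_eq_sum]
  · rw [volume_real_eq_integral]
    simp only [← heval l hl]
    have hexp : ∀ x, MvPolynomial.eval l (p x) = ∑ d ∈ D, (p x).coeff d * ∏ i, l i ^ d i := by
      intro x
      rw [MvPolynomial.eval_eq']
      refine Finset.sum_subset (hD x) fun d _ hd => ?_
      rw [MvPolynomial.notMem_support_iff.1 hd, zero_mul]
    simp only [hexp]
    rw [integral_finsetSum _ fun d _ => (hcoeff d).mul_const _, map_sum]
    refine Finset.sum_congr rfl fun d _ => ?_
    rw [integral_mul_const, MvPolynomial.eval_monomial, Finsupp.prod_fintype _ _ (by simp)]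

end Polynomial

/-! ### Differences of support functions -/

section Differences

variable {n : ℕ}

/-- The linear subspace of `C(S^{n-1})` formed by the differences of support functions. -/
def suppDiff (n : ℕ) : Submodule ℝ C(Sph n, ℝ) where
  carrier := {f | ∃ L M : Body n, f = suppC L - suppC M}
  zero_mem' := ⟨0, 0, by simp⟩
  add_mem' := by
    rintro _ _ ⟨L, M, rfl⟩ ⟨L', M', rfl⟩
    exact ⟨L + L', M + M', by rw [suppC_add, suppC_add]; abel⟩
  smul_mem' := by
    rintro c _ ⟨L, M, rfl⟩
    rcases le_total 0 c with hc | hc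
    · exact ⟨c • L, c • M, by rw [suppC_smul _ hc, suppC_smul _ hc, smul_sub]⟩
    · have hc' : 0 ≤ -c := neg_nonneg.2 hc
      exact ⟨(-c) • M, (-c) • L, by rw [suppC_smul _ hc', suppC_smul _ hc']; module⟩

lemma suppC_mem_suppDiff (K : Body n) : suppC K ∈ suppDiff n :=
  ⟨K, 0, by ext u; simp [supportFn_zero_body]⟩

lemma one_mem_suppDiff : (1 : C(Sph n, ℝ)) ∈ suppDiff n := by
  rw [← suppC_unitBall]; exact suppC_mem_suppDiff _

/-- The differences of support functions form a lattice: the maximum of two of them is the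
difference with the support function of a convex hull. -/
lemma sup_mem_suppDiff {f g : C(Sph n, ℝ)} (hf : f ∈ suppDiff n) (hg : g ∈ suppDiff n) :
    f ⊔ g ∈ suppDiff n := by
  obtain ⟨L, M, rfl⟩ := hf
  obtain ⟨L', M', rfl⟩ := hg
  refine ⟨hullBody (L + M') (L' + M), M + M', ?_⟩
  ext u
  simp only [ContinuousMap.sup_apply, ContinuousMap.sub_apply, suppC_apply, supportFn_hullBody,
    supportFn_body_add]
  rw [← max_sub_sub_right]
  congr 1 <;> ring

lemma inf_mem_suppDiff {f g : C(Sph n, ℝ)} (hf : f ∈ suppDiff n) (hg : g ∈ suppDiff n) :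
    f ⊓ g ∈ suppDiff n := by
  have h : f ⊓ g = -(-f ⊔ -g) := by
    ext u; simp [min_def, max_def]; split_ifs <;> linarith
  rw [h]
  exact neg_mem (sup_mem_suppDiff (neg_mem hf) (neg_mem hg))

lemma dense_suppDiff : Dense (suppDiff n : Set C(Sph n, ℝ)) := by
  rw [dense_iff_closure_eq]
  refine ContinuousMap.sublattice_closure_eq_top _ ⟨0, zero_mem _⟩
    (fun f hf g hg => inf_mem_suppDiff hf hg) (fun f hf g hg => sup_mem_suppDiff hf hg) ?_
  intro v x y
  by_cases hxy : x = y
  · subst hxy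
    exact ⟨v x • 1, (suppDiff n).smul_mem _ one_mem_suppDiff, by simp, by simp⟩
  · -- an affine function of `⟨u, x - y⟩` interpolates the two values
    set w : E n := (x : E n) - y with hw
    have hw0 : (inner ℝ w w : ℝ) ≠ 0 := by
      rw [Ne, inner_self_eq_zero, sub_eq_zero]
      exact fun h => hxy (Subtype.ext h)
    set a : ℝ := (v x - v y) / inner ℝ w w with ha
    have hmem : suppC (pointBody w) ∈ suppDiff n := suppC_mem_suppDiff _
    have hval : ∀ u : Sph n, suppC (pointBody w) u = inner ℝ (u : E n) w := fun u =>
      supportFn_pointBody _ _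
    have hdiff : a * (inner ℝ (x : E n) w - inner ℝ (y : E n) w) = v x - v y := by
      rw [← inner_sub_left, ← hw, ha]; field_simp
    refine ⟨a • suppC (pointBody w) + (v x - a * inner ℝ (x : E n) w) • 1,
      add_mem ((suppDiff n).smul_mem _ hmem) ((suppDiff n).smul_mem _ one_mem_suppDiff), ?_, ?_⟩
    · simp only [ContinuousMap.add_apply, ContinuousMap.smul_apply, hval, smul_eq_mul,
        ContinuousMap.one_apply]
      ring
    · simp only [ContinuousMap.add_apply, ContinuousMap.smul_apply, hval, smul_eq_mul,
        ContinuousMap.one_apply]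
      linarith

/-- A continuous linear functional on `C(S^{n-1})` is determined by its values on support
functions. -/
lemma clm_ext_suppC {Φ Ψ : C(Sph n, ℝ) →L[ℝ] ℝ} (h : ∀ K : Body n, Φ (suppC K) = Ψ (suppC K)) :
    Φ = Ψ := by
  refine ContinuousLinearMap.coeFn_injective (Φ.continuous.ext_on dense_suppDiff Ψ.continuous ?_)
  rintro _ ⟨L, M, rfl⟩
  simp [h]

/-- A continuous linear functional that is monotone on support functions is positive: a nonnegative `g`
is approximated by differences of support functions, which become nonnegative after adding a small
multiple of `1`, the support function of the ball. -/
lemma clm_nonneg {Φ : C(Sph n, ℝ) →L[ℝ] ℝ}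
    (h : ∀ L M : Body n, (∀ u : Sph n, supportFn L u ≤ supportFn M u) →
      Φ (suppC L) ≤ Φ (suppC M))
    {g : C(Sph n, ℝ)} (hg : ∀ u, 0 ≤ g u) : 0 ≤ Φ g := by
  have h1 : 0 ≤ Φ 1 := by
    have := h 0 (unitBall n) fun u => by simp [supportFn_zero_body, supportFn_unitBall]
    rw [suppC_unitBall] at this
    rwa [show suppC (0 : Body n) = 0 by ext u; simp [supportFn_zero_body], map_zero] at this
  refine le_of_forall_pos_le_add fun ε hε => ?_
  have hcont : Filter.Tendsto (fun f => Φ f + dist g f * Φ 1) (nhds g) (nhds (Φ g + dist g g * Φ 1)) :=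
    Continuous.tendsto (f := fun f => Φ f + dist g f * Φ 1) (by fun_prop) g
  rw [dist_self, zero_mul, add_zero] at hcont
  have hev := hcont.eventually (gt_mem_nhds (show Φ g < Φ g + ε by linarith))
  obtain ⟨_, ⟨L, M, rfl⟩, hf⟩ := dense_suppDiff.inter_nhds_nonempty hev
  set r := dist g (suppC L - suppC M) with hr
  have h2 := h M (L + r • unitBall n) fun u => by
    rw [supportFn_body_add, supportFn_body_smul _ dist_nonneg, supportFn_unitBall,
      norm_eq_of_mem_sphere u, mul_one]
    have h3 := ContinuousMap.dist_apply_le_dist (f := g) (g := suppC L - suppC M) u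
    rw [Real.dist_eq, ContinuousMap.sub_apply, suppC_apply, suppC_apply, ← hr] at h3
    have := (abs_le.1 h3).2
    linarith [hg u]
  rw [suppC_add, suppC_smul _ dist_nonneg, suppC_unitBall, map_add, map_smul, smul_eq_mul] at h2
  have h4 : Φ (suppC L - suppC M) + r * Φ 1 < Φ g + ε := hf
  rw [map_sub] at h4
  linarith

/-- Integration against a finite measure, as a continuous linear functional. -/
def intCLM (m : Measure (Sph n)) [IsFiniteMeasure m] : C(Sph n, ℝ) →L[ℝ] ℝ :=
  LinearMap.mkContinuous
    { toFun := fun g => ∫ u, g u ∂m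
      map_add' := fun f g => integral_add
        (f.continuous.integrable_of_hasCompactSupport (HasCompactSupport.of_compactSpace _))
        (g.continuous.integrable_of_hasCompactSupport (HasCompactSupport.of_compactSpace _))
      map_smul' := fun c g => integral_const_mul c _ }
    (m.real Set.univ) fun g => by
      have := norm_integral_le_of_norm_le_const (μ := m)
        (Filter.Eventually.of_forall fun u => g.norm_coe_le_norm u)
      rw [mul_comm]
      exact this

lemma intCLM_apply (m : Measure (Sph n)) [IsFiniteMeasure m] (g : C(Sph n, ℝ)) :
    intCLM m g = ∫ u, g u ∂m := rfl

/-- The Riesz representation theorem on the sphere. -/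
lemma exists_measure_of_nonneg (Φ : C(Sph n, ℝ) →ₗ[ℝ] ℝ)
    (h : ∀ g : C(Sph n, ℝ), (∀ u, 0 ≤ g u) → 0 ≤ Φ g) :
    ∃ m : Measure (Sph n), IsFiniteMeasure m ∧ ∀ g : C(Sph n, ℝ), ∫ u, g u ∂m = Φ g := by
  let Λ : CompactlySupportedContinuousMap (Sph n) ℝ →ₚ[ℝ] ℝ := PositiveLinearMap.mk₀
    { toFun := fun f => Φ f.toContinuousMap
      map_add' := fun f g => by rw [← map_add]; rfl
      map_smul' := fun c f => by rw [RingHom.id_apply, ← map_smul]; rfl }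
    (fun f hf => h _ fun u => hf u)
  refine ⟨RealRMK.rieszMeasure Λ, inferInstance, fun g => ?_⟩
  let g' : CompactlySupportedContinuousMap (Sph n) ℝ :=
    { toContinuousMap := g
      hasCompactSupport' := HasCompactSupport.of_compactSpace _ }
  exact RealRMK.integral_rieszMeasure Λ g'

/-- An additive, positively homogeneous and monotone function of convex bodies is integration of
the support function against a measure. -/
theorem exists_measure_of_monotone {d : Body n → ℝ} (hadd : ∀ L M, d (L + M) = d L + d M)
    (hsmul : ∀ (t : ℝ) (L : Body n), 0 ≤ t → d (t • L) = t * d L)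
    (hmono : ∀ L M : Body n, (L : Set (E n)) ⊆ M → d L ≤ d M) :
    ∃ m : Measure (Sph n), IsFiniteMeasure m ∧ ∀ L, ∫ u : Sph n, supportFn L u ∂m = d L := by
  have hwd : ∀ L M L' M' : Body n, suppC L - suppC M = suppC L' - suppC M' →
      d L - d M = d L' - d M' := fun L M L' M' h => by
    have h1 : L + M' = L' + M := suppC_injective (by
      rw [suppC_add, suppC_add]
      rw [sub_eq_sub_iff_add_eq_add] at h
      exact h)
    have h2 := congrArg d h1
    rw [hadd, hadd] at h2
    linarith
  have hchoose : ∀ f : suppDiff n, ∃ a : ℝ, ∀ L M : Body n, (f : C(Sph n, ℝ)) = suppC L - suppC M →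
      a = d L - d M := fun f => by
    obtain ⟨L, M, h⟩ := f.2
    exact ⟨d L - d M, fun L' M' h' => hwd _ _ _ _ (h.symm.trans h')⟩
  choose φ hφ using hchoose
  -- the linear functional `h_L - h_M ↦ d L - d M`
  let F : C(Sph n, ℝ) →ₗ.[ℝ] ℝ :=
    { domain := suppDiff n
      toFun :=
        { toFun := φ
          map_add' := by
            rintro ⟨_, L, M, rfl⟩ ⟨_, L', M', rfl⟩
            rw [hφ ⟨_, L, M, rfl⟩ L M rfl, hφ ⟨_, L', M', rfl⟩ L' M' rfl, hφ _ (L + L') (M + M') (by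
              rw [suppC_add, suppC_add]; exact sub_add_sub_comm _ _ _ _), hadd, hadd]
            ring
          map_smul' := by
            rintro c ⟨_, L, M, rfl⟩
            rw [hφ ⟨_, L, M, rfl⟩ L M rfl, RingHom.id_apply, smul_eq_mul]
            rcases le_total 0 c with hc | hc
            · rw [hφ _ (c • L) (c • M) (by
                rw [suppC_smul _ hc, suppC_smul _ hc, ← smul_sub]; rfl), hsmul _ _ hc, hsmul _ _ hc]
              ring
            · have hc' : 0 ≤ -c := neg_nonneg.2 hc
              rw [hφ _ ((-c) • M) ((-c) • L) (by
                rw [suppC_smul _ hc', suppC_smul _ hc']; change c • _ = _; module), hsmul _ _ hc',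
                hsmul _ _ hc']
              ring } }
  let s : PointedCone ℝ C(Sph n, ℝ) :=
    { carrier := {g | ∀ u, 0 ≤ g u}
      zero_mem' := fun u => le_rfl
      add_mem' := fun hf hg u => add_nonneg (hf u) (hg u)
      smul_mem' := fun c f hf u => mul_nonneg c.2 (hf u) }
  -- the constants, which dominate every continuous function, belong to the domain of `F`
  obtain ⟨Φ, hΦ, hpos⟩ := riesz_extension s F (by
    rintro ⟨_, L, M, rfl⟩ hs
    change 0 ≤ φ _
    rw [hφ _ L M rfl, sub_nonneg]
    exact hmono _ _ (subset_of_supportFn_le fun u => sub_nonneg.1 (hs u))) (by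
    intro g
    refine ⟨⟨‖g‖ • 1, (suppDiff n).smul_mem _ one_mem_suppDiff⟩, fun u => ?_⟩
    have := (abs_le.1 (g.norm_coe_le_norm u)).1
    simp only [ContinuousMap.add_apply, ContinuousMap.smul_apply, ContinuousMap.one_apply,
      smul_eq_mul]
    linarith)
  obtain ⟨m, hm, hint⟩ := exists_measure_of_nonneg Φ hpos
  refine ⟨m, hm, fun L => (hint (suppC L)).trans ?_⟩
  rw [hΦ ⟨suppC L, suppC_mem_suppDiff L⟩]
  change φ _ = _
  have h0 : d 0 = 0 := by
    have := hsmul 0 0 le_rfl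
    rwa [zero_smul_body, zero_mul] at this
  rw [hφ _ L 0 (by ext u; simp [supportFn_zero_body]), h0, sub_zero]

end Differences

/-! ### First variation of volume and surface area measures -/

section FirstVariation

variable {n : ℕ}

/-- The volume of a convex body. -/
def vol (K : Body n) : ℝ := (volume : Measure (E n)).real (K : Set (E n))

lemma vol_mono {K L : Body n} (h : (K : Set (E n)) ⊆ L) : vol K ≤ vol L :=
  measureReal_mono h L.isCompact.measure_lt_top.ne

/-- The right derivative at `0` of `t ↦ vol (Q + t L)`. -/
def firstVar (Q L : Body n) : ℝ := derivWithin (fun t : ℝ => vol (Q + t • L)) (Set.Ici 0) 0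

/-- The directional derivative of a polynomial in terms of its formal partial derivatives. -/
lemma hasDerivAt_eval_line {ι : Type*} [Fintype ι] (P : MvPolynomial ι ℝ) (x v : ι → ℝ) :
    HasDerivAt (fun t : ℝ => MvPolynomial.eval (x + t • v) P)
      (∑ i, v i * MvPolynomial.eval x (MvPolynomial.pderiv i P)) 0 := by
  classical
  induction P using MvPolynomial.induction_on with
  | C a => simpa using hasDerivAt_const (0 : ℝ) a
  | add p q hp hq =>
    simp only [map_add]
    refine (hp.add hq).congr_deriv ?_
    rw [← Finset.sum_add_distrib]
    exact Finset.sum_congr rfl fun i _ => by ring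
  | mul_X p j hp =>
    have h1 : HasDerivAt (fun t : ℝ => (x + t • v) j) (v j) 0 := by
      simpa using ((hasDerivAt_id (0 : ℝ)).mul_const (v j)).const_add (x j)
    simp only [map_mul, MvPolynomial.eval_X]
    refine (hp.mul h1).congr_deriv ?_
    simp only [zero_smul, add_zero, Derivation.leibniz, smul_eq_mul, MvPolynomial.pderiv_X,
      Pi.single_apply, map_add, map_mul, MvPolynomial.eval_X, mul_add, Finset.sum_add_distrib,
      apply_ite (MvPolynomial.eval x), map_zero, mul_ite, mul_one, mul_zero,
      Finset.sum_ite_eq, Finset.mem_univ, if_true]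
    rw [Finset.sum_mul, add_comm]
    congr 1
    · simp [mul_comm]
    · exact Finset.sum_congr rfl fun i _ => by ring

lemma comb_add_smul {ι : Type*} [Fintype ι] (K : ι → Body n) {x v : ι → ℝ} (hx : ∀ i, 0 ≤ x i)
    (hv : ∀ i, 0 ≤ v i) {t : ℝ} (ht : 0 ≤ t) :
    (∑ i, x i • K i) + t • (∑ i, v i • K i) = ∑ i, (x + t • v) i • K i := by
  rw [Finset.smul_sum, ← Finset.sum_add_distrib]
  refine Finset.sum_congr rfl fun i _ => ?_
  rw [Pi.add_apply, Pi.smul_apply, smul_eq_mul, add_smul_body _ (hx i) (mul_nonneg ht (hv i)),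
    mul_smul]

section Poly

variable {ι : Type*} [Fintype ι] {K : ι → Body n} {P : MvPolynomial ι ℝ}

lemma hasDerivWithinAt_vol_comb
    (hP : ∀ l : ι → ℝ, (∀ i, 0 ≤ l i) → vol (∑ i, l i • K i) = MvPolynomial.eval l P)
    {x v : ι → ℝ} (hx : ∀ i, 0 ≤ x i) (hv : ∀ i, 0 ≤ v i) :
    HasDerivWithinAt (fun t : ℝ => vol ((∑ i, x i • K i) + t • (∑ i, v i • K i)))
      (∑ i, v i * MvPolynomial.eval x (MvPolynomial.pderiv i P)) (Set.Ici 0) 0 := by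
  refine (hasDerivAt_eval_line P x v).hasDerivWithinAt.congr_of_mem (fun t ht => ?_) (by simp)
  have ht' : (0 : ℝ) ≤ t := ht
  rw [comb_add_smul K hx hv ht', hP _ fun i => ?_]
  exact add_nonneg (hx i) (mul_nonneg ht' (hv i))

lemma firstVar_comb
    (hP : ∀ l : ι → ℝ, (∀ i, 0 ≤ l i) → vol (∑ i, l i • K i) = MvPolynomial.eval l P)
    {x v : ι → ℝ} (hx : ∀ i, 0 ≤ x i) (hv : ∀ i, 0 ≤ v i) :
    firstVar (∑ i, x i • K i) (∑ i, v i • K i) =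
      ∑ i, v i * MvPolynomial.eval x (MvPolynomial.pderiv i P) :=
  (hasDerivWithinAt_vol_comb hP hx hv).derivWithin (uniqueDiffOn_Ici 0 0 (by simp))

end Poly

lemma hasDerivWithinAt_vol (Q L : Body n) :
    HasDerivWithinAt (fun t : ℝ => vol (Q + t • L)) (firstVar Q L) (Set.Ici 0) 0 := by
  obtain ⟨P, -, hP⟩ := exists_volume_polynomial ![Q, L]
  have h := hasDerivWithinAt_vol_comb hP (x := ![1, 0]) (v := ![0, 1])
    (by simp [Fin.forall_fin_two]) (by simp [Fin.forall_fin_two])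
  simp only [Fin.sum_univ_two, Matrix.cons_val_zero, Matrix.cons_val_one, one_smul,
    zero_smul_body, add_zero, zero_add] at h
  exact h.differentiableWithinAt.hasDerivWithinAt

lemma firstVar_eq_of_hasDerivWithinAt {Q L : Body n} {a : ℝ}
    (h : HasDerivWithinAt (fun t : ℝ => vol (Q + t • L)) a (Set.Ici 0) 0) : firstVar Q L = a :=
  h.derivWithin (uniqueDiffOn_Ici 0 0 (by simp))

lemma firstVar_add (Q L M : Body n) : firstVar Q (L + M) = firstVar Q L + firstVar Q M := by
  obtain ⟨P, -, hP⟩ := exists_volume_polynomial ![Q, L, M]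
  have hx : ∀ i, (0 : ℝ) ≤ ![(1 : ℝ), 0, 0] i := by simp [Fin.forall_fin_succ]
  have h1 := firstVar_comb hP (v := ![0, 1, 0]) hx (by simp [Fin.forall_fin_succ])
  have h2 := firstVar_comb hP (v := ![0, 0, 1]) hx (by simp [Fin.forall_fin_succ])
  have h3 := firstVar_comb hP (v := ![0, 1, 1]) hx (by simp [Fin.forall_fin_succ])
  simp only [Fin.sum_univ_three, Matrix.cons_val_zero, Matrix.cons_val_one, Matrix.cons_val, one_smul,
    zero_smul_body, add_zero, zero_add, zero_mul, one_mul] at h1 h2 h3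
  rw [h1, h2, h3]

lemma firstVar_smul (Q : Body n) (c : ℝ) (L : Body n) (hc : 0 ≤ c) :
    firstVar Q (c • L) = c * firstVar Q L := by
  obtain ⟨P, -, hP⟩ := exists_volume_polynomial ![Q, L]
  have hx : ∀ i, (0 : ℝ) ≤ ![(1 : ℝ), 0] i := by simp [Fin.forall_fin_succ]
  have h1 := firstVar_comb hP (v := ![0, 1]) hx (by simp [Fin.forall_fin_succ])
  have h2 := firstVar_comb hP (v := ![0, c]) hx (by simp [Fin.forall_fin_succ, hc])
  simp only [Fin.sum_univ_two, Matrix.cons_val_zero, Matrix.cons_val_one, one_smul,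
    zero_smul_body, add_zero, zero_add, zero_mul, one_mul] at h1 h2
  rw [h1, h2]

lemma nonneg_of_hasDerivWithinAt_Ici {f : ℝ → ℝ} {a : ℝ}
    (h : HasDerivWithinAt f a (Set.Ici 0) 0) (hf : ∀ᶠ t in nhdsWithin 0 (Set.Ioi 0), f 0 ≤ f t) : 0 ≤ a := by
  rw [hasDerivWithinAt_iff_tendsto_slope, Set.Ici_sdiff_left] at h
  refine ge_of_tendsto h ?_
  filter_upwards [self_mem_nhdsWithin, hf] with t ht hft
  rw [slope_def_field]
  exact div_nonneg (sub_nonneg.2 hft) (by rw [sub_zero]; exact (Set.mem_Ioi.1 ht).le)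

lemma firstVar_mono (Q : Body n) {L M : Body n} (h : (L : Set (E n)) ⊆ M) :
    firstVar Q L ≤ firstVar Q M := by
  rw [← sub_nonneg]
  refine nonneg_of_hasDerivWithinAt_Ici
    ((hasDerivWithinAt_vol Q M).sub (hasDerivWithinAt_vol Q L)) (Filter.Eventually.of_forall fun t => ?_)
  simp only [Pi.sub_apply, zero_smul_body, sub_self, sub_nonneg]
  exact vol_mono (Set.add_subset_add_left (Set.smul_set_mono h))

/-- Existence of the surface area measure. -/
theorem exists_isSurfaceAreaMeasure (Q : Body n) : ∃ m, IsSurfaceAreaMeasure Q m := by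
  obtain ⟨m, hm, h⟩ := exists_measure_of_monotone (firstVar_add Q)
    (fun c L hc => firstVar_smul Q c L hc) (fun L M h => firstVar_mono Q h)
  refine ⟨m, hm, fun L => ?_⟩
  rw [h L]
  exact hasDerivWithinAt_vol Q L

instance (Q : Body n) : IsFiniteMeasure (surfaceAreaMeasure Q) := by
  rw [surfaceAreaMeasure, dif_pos (exists_isSurfaceAreaMeasure Q)]
  exact (exists_isSurfaceAreaMeasure Q).choose_spec.1

lemma integral_surfaceAreaMeasure (Q L : Body n) :
    ∫ u : Sph n, supportFn L u ∂(surfaceAreaMeasure Q) = firstVar Q L := by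
  rw [surfaceAreaMeasure, dif_pos (exists_isSurfaceAreaMeasure Q)]
  exact (firstVar_eq_of_hasDerivWithinAt ((exists_isSurfaceAreaMeasure Q).choose_spec.2 L)).symm

/-- The functional `g ↦ ∫ g dS_{n-1}(Q)`. -/
def surfCLM (Q : Body n) : C(Sph n, ℝ) →L[ℝ] ℝ := intCLM (surfaceAreaMeasure Q)

lemma surfCLM_suppC (Q L : Body n) : surfCLM Q (suppC L) = firstVar Q L :=
  integral_surfaceAreaMeasure Q L

end FirstVariation

/-! ### The mixed second variation of volume at the ball -/

section MixedVariation

variable {n : ℕ}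

/-- The mixed second derivative at `0` of `(l, t) ↦ vol (B + l K + t L)`, where `B` is the unit
ball; up to a constant factor this is the mixed volume `V(K, L, B, …, B)`. -/
def mixVar (K L : Body n) : ℝ :=
  derivWithin (fun l : ℝ => firstVar (unitBall n + l • K) L) (Set.Ici 0) 0

section Poly

variable {ι : Type*} [Fintype ι] {K : ι → Body n} {P : MvPolynomial ι ℝ}

lemma hasDerivWithinAt_firstVar_comb
    (hP : ∀ l : ι → ℝ, (∀ i, 0 ≤ l i) → vol (∑ i, l i • K i) = MvPolynomial.eval l P)
    {x v w : ι → ℝ} (hx : ∀ i, 0 ≤ x i) (hv : ∀ i, 0 ≤ v i) (hw : ∀ i, 0 ≤ w i) :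
    HasDerivWithinAt
      (fun l : ℝ => firstVar ((∑ i, x i • K i) + l • (∑ i, v i • K i)) (∑ i, w i • K i))
      (∑ j, w j * ∑ i, v i * MvPolynomial.eval x (MvPolynomial.pderiv i (MvPolynomial.pderiv j P)))
      (Set.Ici 0) 0 := by
  have h : HasDerivAt
      (fun l : ℝ => ∑ j, w j * MvPolynomial.eval (x + l • v) (MvPolynomial.pderiv j P))
      (∑ j, w j * ∑ i, v i * MvPolynomial.eval x (MvPolynomial.pderiv i (MvPolynomial.pderiv j P)))
      0 :=
    HasDerivAt.fun_sum fun j _ => (hasDerivAt_eval_line _ x v).const_mul (w j)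
  refine h.hasDerivWithinAt.congr_of_mem (fun l hl => ?_) (by simp)
  have hl' : (0 : ℝ) ≤ l := hl
  rw [comb_add_smul K hx hv hl', firstVar_comb hP (fun i => ?_) hw]
  exact add_nonneg (hx i) (mul_nonneg hl' (hv i))

lemma mixVar_comb
    (hP : ∀ l : ι → ℝ, (∀ i, 0 ≤ l i) → vol (∑ i, l i • K i) = MvPolynomial.eval l P)
    {x v w : ι → ℝ} (hx : ∀ i, 0 ≤ x i) (hv : ∀ i, 0 ≤ v i) (hw : ∀ i, 0 ≤ w i)
    (hB : ∑ i, x i • K i = unitBall n) :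
    mixVar (∑ i, v i • K i) (∑ i, w i • K i) =
      ∑ j, w j * ∑ i, v i * MvPolynomial.eval x (MvPolynomial.pderiv i (MvPolynomial.pderiv j P)) := by
  have h := hasDerivWithinAt_firstVar_comb hP hx hv hw
  rw [hB] at h
  exact h.derivWithin (uniqueDiffOn_Ici 0 0 (by simp))

end Poly

lemma hasDerivWithinAt_firstVar (K L : Body n) :
    HasDerivWithinAt (fun l : ℝ => firstVar (unitBall n + l • K) L) (mixVar K L) (Set.Ici 0) 0 := by
  obtain ⟨P, -, hP⟩ := exists_volume_polynomial ![unitBall n, K, L]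
  have h := hasDerivWithinAt_firstVar_comb hP (x := ![1, 0, 0]) (v := ![0, 1, 0]) (w := ![0, 0, 1])
    (by simp [Fin.forall_fin_succ]) (by simp [Fin.forall_fin_succ]) (by simp [Fin.forall_fin_succ])
  simp only [Fin.sum_univ_three, Matrix.cons_val_zero, Matrix.cons_val_one, Matrix.cons_val,
    one_smul, zero_smul_body, add_zero, zero_add] at h
  exact h.differentiableWithinAt.hasDerivWithinAt

lemma pderiv_pderiv_comm {ι : Type*} (i j : ι) (P : MvPolynomial ι ℝ) :
    MvPolynomial.pderiv i (MvPolynomial.pderiv j P) =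
      MvPolynomial.pderiv j (MvPolynomial.pderiv i P) := by
  classical
  have h : ⁅MvPolynomial.pderiv (R := ℝ) i, MvPolynomial.pderiv (R := ℝ) j⁆ = 0 := by
    refine MvPolynomial.derivation_ext (R := ℝ) (σ := ι) fun k => ?_
    simp [Derivation.commutator_apply, MvPolynomial.pderiv_X, Pi.single_apply, apply_ite]
  have := congrArg (fun D => D P) h
  simpa [Derivation.commutator_apply, sub_eq_zero] using this

/-- The symmetry `V(K, L, B, …, B) = V(L, K, B, …, B)`, from the symmetry of second partial
derivatives of the volume polynomial. -/
lemma mixVar_comm (K L : Body n) : mixVar K L = mixVar L K := by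
  obtain ⟨P, -, hP⟩ := exists_volume_polynomial ![unitBall n, K, L]
  have hx : ∀ i, (0 : ℝ) ≤ ![(1 : ℝ), 0, 0] i := by simp [Fin.forall_fin_succ]
  have h1 : ∀ i, (0 : ℝ) ≤ ![(0 : ℝ), 1, 0] i := by simp [Fin.forall_fin_succ]
  have h2 : ∀ i, (0 : ℝ) ≤ ![(0 : ℝ), 0, 1] i := by simp [Fin.forall_fin_succ]
  have hB : ∑ i, ![(1 : ℝ), 0, 0] i • ![unitBall n, K, L] i = unitBall n := by
    simp [Fin.sum_univ_three, zero_smul_body]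
  have e1 := mixVar_comb hP hx h1 h2 hB
  have e2 := mixVar_comb hP hx h2 h1 hB
  simp only [Fin.sum_univ_three, Matrix.cons_val_zero, Matrix.cons_val_one, Matrix.cons_val,
    one_smul, zero_smul_body, add_zero, zero_add, zero_mul, one_mul] at e1 e2
  rw [e1, e2, pderiv_pderiv_comm]

lemma mixVar_add_right (K L M : Body n) : mixVar K (L + M) = mixVar K L + mixVar K M := by
  have h := (hasDerivWithinAt_firstVar K L).add (hasDerivWithinAt_firstVar K M)
  refine Eq.trans ?_ (h.derivWithin (uniqueDiffOn_Ici 0 0 (by simp)))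
  simp only [mixVar, firstVar_add]
  rfl

lemma mixVar_smul_right (K L : Body n) {c : ℝ} (hc : 0 ≤ c) :
    mixVar K (c • L) = c * mixVar K L := by
  have h := (hasDerivWithinAt_firstVar K L).const_mul c
  refine Eq.trans ?_ (h.derivWithin (uniqueDiffOn_Ici 0 0 (by simp)))
  simp only [mixVar, firstVar_smul _ _ _ hc]

lemma mixVar_add_left (K L M : Body n) : mixVar (K + L) M = mixVar K M + mixVar L M := by
  rw [mixVar_comm, mixVar_add_right, mixVar_comm M, mixVar_comm M]

lemma mixVar_smul_left (K L : Body n) {c : ℝ} (hc : 0 ≤ c) :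
    mixVar (c • K) L = c * mixVar K L := by
  rw [mixVar_comm, mixVar_smul_right _ _ hc, mixVar_comm]

/-! ### Monotonicity of the mixed variation -/

/-- A map that does not decrease distances does not decrease Lebesgue measure. -/
lemma volume_le_volume_image {f : E n → E n} (hf : AntilipschitzWith 1 f) (s : Set (E n)) :
    volume s ≤ volume (f '' s) := by
  have h := Measure.isAddLeftInvariant_eq_smul (volume : Measure (E n))
    (Measure.hausdorffMeasure (Module.finrank ℝ (E n) : ℝ))
  have h1 := hf.le_hausdorffMeasure_image (Nat.cast_nonneg (Module.finrank ℝ (E n))) s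
  rw [ENNReal.coe_one, ENNReal.one_rpow, one_mul] at h1
  rw [h]
  simp only [Measure.smul_apply]
  gcongr

lemma antilipschitz_add_support {K : Body n} {k : E n → E n}
    (hk : ∀ y, k y ∈ K ∧ inner ℝ y (k y) = supportFn K y) :
    AntilipschitzWith 1 fun y => y + k y := by
  refine AntilipschitzWith.of_le_mul_dist fun y y' => ?_
  rw [NNReal.coe_one, one_mul, dist_eq_norm, dist_eq_norm]
  -- the map `k` is monotone
  have hmono : 0 ≤ inner ℝ (y - y') (k y - k y') := by
    have h1 := inner_le_supportFn (hk y').1 y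
    have h2 := inner_le_supportFn (hk y).1 y'
    rw [← (hk y).2] at h1
    rw [← (hk y').2] at h2
    simp only [inner_sub_left, inner_sub_right]
    linarith
  refine le_of_sq_le_sq ?_ (norm_nonneg _) |>.trans_eq rfl
  rw [show y + k y - (y' + k y') = (y - y') + (k y - k y') by abel, norm_add_sq_real]
  nlinarith [sq_nonneg ‖k y - k y'‖]

/-- Adding a convex body `K` to the ball increases the volume gained in passing from `t L` to
`t M`, to first order in `t`: the points `y` gained without `K` are moved injectively, without
decreasing distances, to points `y + k` gained with `K`, where `k` is a point of `K` with outer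
normal `y`. -/
lemma vol_add_sub_le {K L M : Body n} (hLM : (L : Set (E n)) ⊆ M) {R δ t : ℝ}
    (hR : ∀ z ∈ L, ‖z‖ ≤ R) (hδ : 0 ≤ δ) (ht : 0 < t) (htR : t * R ^ 2 ≤ 2 * δ) :
    vol (unitBall n + t • M) - vol (unitBall n + t • (L + δ • unitBall n)) ≤
      vol (unitBall n + K + t • M) - vol (unitBall n + K + t • L) := by
  choose k hkK hk using exists_inner_eq_supportFn K
  set Y : Set (E n) := ((unitBall n + t • M : Body n) : Set (E n)) \
    ((unitBall n + t • (L + δ • unitBall n) : Body n) : Set (E n)) with hY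
  set A : Body n := unitBall n + K + t • M
  set A' : Body n := unitBall n + K + t • L
  have hAA' : (A' : Set (E n)) ⊆ A := Set.add_subset_add_left (Set.smul_set_mono hLM)
  have himg : (fun y => y + k y) '' Y ⊆ (A : Set (E n)) \ A' := by
    rintro _ ⟨y, ⟨hy, hy'⟩, rfl⟩
    refine ⟨?_, fun hx => hy' ?_⟩
    · change _ ∈ ((unitBall n + K + t • M : Body n) : Set (E n))
      rw [add_right_comm]
      exact Set.add_mem_add hy (hkK y)
    obtain ⟨z, hz, hzy⟩ := exists_inner_eq_supportFn L y
    have h1 := inner_le_supportFn (K := A') hx y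
    rw [inner_add_right, hk, supportFn_body_add, supportFn_body_add, supportFn_unitBall,
      supportFn_body_smul _ ht.le, real_inner_self_eq_norm_sq, ← hzy] at h1
    have h2 : ‖y - t • z‖ ≤ 1 + t * δ := by
      refine le_of_sq_le_sq ?_ (by positivity)
      rw [norm_sub_sq_real, norm_smul, real_inner_smul_right, Real.norm_of_nonneg ht.le]
      have h3 : (t * ‖z‖) ^ 2 ≤ t * (2 * δ) := by
        have : ‖z‖ ^ 2 ≤ R ^ 2 := pow_le_pow_left₀ (norm_nonneg _) (hR z hz) 2
        calc (t * ‖z‖) ^ 2 = t * (t * ‖z‖ ^ 2) := by ring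
          _ ≤ t * (t * R ^ 2) := by gcongr
          _ ≤ _ := by gcongr
      -- by `h1`, `‖y‖² - 2 t ⟨y, z⟩ ≤ 2 ‖y‖ - ‖y‖² ≤ 1`
      nlinarith [sq_nonneg (‖y‖ - 1), sq_nonneg (t * δ)]
    refine mem_of_forall_inner_le (K := unitBall n + t • (L + δ • unitBall n)) fun u => ?_
    rw [supportFn_body_add, supportFn_body_smul _ ht.le, supportFn_body_add,
      supportFn_body_smul _ hδ, supportFn_unitBall]
    have h3 : inner ℝ u y = inner ℝ u (y - t • z) + t * inner ℝ u z := by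
      rw [inner_sub_right, real_inner_smul_right]; ring
    have h4 : inner ℝ u (y - t • z) ≤ ‖u‖ * ‖y - t • z‖ := real_inner_le_norm _ _
    have h5 := mul_le_mul_of_nonneg_left h2 (norm_nonneg u)
    have h6 := mul_le_mul_of_nonneg_left (inner_le_supportFn hz u) ht.le
    rw [h3]
    linarith
  have hvol : (volume : Measure (E n)).real Y ≤ (volume : Measure (E n)).real ((A : Set (E n)) \ A') :=
    ENNReal.toReal_mono ((measure_mono Set.sdiff_subset).trans_lt A.isCompact.measure_lt_top).ne
      ((volume_le_volume_image (antilipschitz_add_support fun y => ⟨hkK y, hk y⟩) Y).trans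
        (measure_mono himg))
  have h1 : (volume : Measure (E n)).real ((A : Set (E n)) \ A') = vol A - vol A' :=
    measureReal_sdiff hAA' A'.isClosed.measurableSet A.isCompact.measure_lt_top.ne
  have h2 : vol (unitBall n + t • M) - vol (unitBall n + t • (L + δ • unitBall n)) ≤
      (volume : Measure (E n)).real Y :=
    le_measureReal_sdiff (ConvexBody.isCompact _).measure_lt_top.ne
  linarith

lemma firstVar_ball_sub_le (K : Body n) {L M : Body n} (hLM : (L : Set (E n)) ⊆ M) :
    firstVar (unitBall n) M - firstVar (unitBall n) L ≤
      firstVar (unitBall n + K) M - firstVar (unitBall n + K) L := by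
  obtain ⟨R, hR, hRL⟩ := exists_norm_le L
  have key : ∀ δ : ℝ, 0 < δ → firstVar (unitBall n) M - firstVar (unitBall n) L ≤
      firstVar (unitBall n + K) M - firstVar (unitBall n + K) L +
        δ * firstVar (unitBall n) (unitBall n) := by
    intro δ hδ
    have hd := (((hasDerivWithinAt_vol (unitBall n + K) M).sub
      (hasDerivWithinAt_vol (unitBall n + K) L)).sub
      ((hasDerivWithinAt_vol (unitBall n) M).sub
      (hasDerivWithinAt_vol (unitBall n) (L + δ • unitBall n))))
    rw [firstVar_add, firstVar_smul _ _ _ hδ.le] at hd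
    have h0 := nonneg_of_hasDerivWithinAt_Ici hd (by
      filter_upwards [Ioo_mem_nhdsGT (show (0 : ℝ) < 2 * δ / R ^ 2 by positivity)] with t ht
      have h1 := vol_add_sub_le (K := K) hLM hRL hδ.le ht.1 (by
        have := ht.2.le
        rwa [le_div_iff₀ (by positivity)] at this)
      simp only [Pi.sub_apply, zero_smul_body, sub_self]
      linarith)
    linarith
  refine le_of_forall_pos_le_add fun ε hε => ?_
  set b := firstVar (unitBall n) (unitBall n)
  have h := key (ε / (|b| + 1)) (by positivity)
  refine h.trans (add_le_add le_rfl ?_)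
  rw [div_mul_eq_mul_div, div_le_iff₀ (by positivity)]
  nlinarith [le_abs_self b]

/-- Monotonicity of `V(K, ·, B, …, B)`. -/
lemma mixVar_mono (K : Body n) {L M : Body n} (hLM : (L : Set (E n)) ⊆ M) :
    mixVar K L ≤ mixVar K M := by
  rw [← sub_nonneg]
  refine nonneg_of_hasDerivWithinAt_Ici
    ((hasDerivWithinAt_firstVar K M).sub (hasDerivWithinAt_firstVar K L)) ?_
  refine Filter.Eventually.of_forall fun l => ?_
  simp only [Pi.sub_apply, zero_smul_body, add_zero]
  exact firstVar_ball_sub_le (l • K) hLM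

end MixedVariation

/-! ### The first area measure -/

section MultilinearCoefficient

variable {σ : Type*} [DecidableEq σ]

lemma sum_single_apply (t : Finset σ) (i : σ) :
    (∑ j ∈ t, Finsupp.single j 1 : σ →₀ ℕ) i = if i ∈ t then 1 else 0 := by
  simp [Finsupp.finsetSum_apply, Finsupp.single_apply]

lemma coeff_X_mul_sum_single (i : σ) (t : Finset σ) (Q : MvPolynomial σ ℝ) :
    (MvPolynomial.X i * Q).coeff (∑ j ∈ t, Finsupp.single j 1) =
      if i ∈ t then Q.coeff (∑ j ∈ t.erase i, Finsupp.single j 1) else 0 := by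
  rw [MvPolynomial.coeff_X_mul']
  simp only [Finsupp.mem_support_iff, sum_single_apply]
  by_cases hi : i ∈ t
  · rw [← Finset.add_sum_erase t _ hi, add_tsub_cancel_left]
    simp [hi]
  · simp [hi]

lemma coeff_sum_X_pow_of_notMem {a : σ} {s : Finset σ} (ha : a ∉ s) (k : ℕ) {t : Finset σ}
    (hat : a ∈ t) :
    ((∑ i ∈ s, MvPolynomial.X i : MvPolynomial σ ℝ) ^ k).coeff (∑ j ∈ t, Finsupp.single j 1) = 0 := by
  induction k generalizing t with
  | zero =>
    rw [pow_zero, MvPolynomial.coeff_one, if_neg]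
    intro h
    have := DFunLike.congr_fun h a
    rw [sum_single_apply, if_pos hat] at this
    simp at this
  | succ k ih =>
    rw [pow_succ', Finset.sum_mul, MvPolynomial.coeff_sum]
    refine Finset.sum_eq_zero fun i hi => ?_
    rw [coeff_X_mul_sum_single]
    split_ifs
    · exact ih (Finset.mem_erase.2 ⟨fun h => ha (h ▸ hi), hat⟩)
    · rfl

lemma coeff_sum_X_pow_card {s t : Finset σ} (hts : t ⊆ s) :
    ((∑ i ∈ s, MvPolynomial.X i : MvPolynomial σ ℝ) ^ t.card).coeff
      (∑ j ∈ t, Finsupp.single j 1) = (t.card.factorial : ℝ) := by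
  induction hk : t.card generalizing t with
  | zero =>
    rw [Finset.card_eq_zero] at hk
    simp [hk]
  | succ k ih =>
    rw [pow_succ', Finset.sum_mul, MvPolynomial.coeff_sum]
    have h : ∀ i ∈ s, (MvPolynomial.X i * (∑ i ∈ s, MvPolynomial.X i : MvPolynomial σ ℝ) ^ k).coeff
        (∑ j ∈ t, Finsupp.single j 1) = if i ∈ t then (k.factorial : ℝ) else 0 := fun i _ => by
      rw [coeff_X_mul_sum_single]
      split_ifs with hit
      · exact ih ((Finset.erase_subset _ _).trans hts) (by rw [Finset.card_erase_of_mem hit, hk]; rfl)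
      · rfl
    rw [Finset.sum_congr rfl h, ← Finset.sum_filter, Finset.filter_mem_eq_inter,
      Finset.inter_eq_right.2 hts, Finset.sum_const, hk, nsmul_eq_mul, Nat.factorial_succ]
    push_cast
    ring

/-- The coefficient of the squarefree monomial in `X₀ ^ j (∑_{i ≠ 0} X_i) ^ (N - j)`, where `N` is
the number of variables. -/
lemma coeff_X_pow_mul_sum_X_pow [Fintype σ] (a : σ) (j : ℕ) :
    (MvPolynomial.X a ^ j * (∑ i ∈ Finset.univ.erase a, MvPolynomial.X i : MvPolynomial σ ℝ) ^
      (Fintype.card σ - j)).coeff (∑ i, Finsupp.single i 1) =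
      if j = 1 then ((Fintype.card σ - 1).factorial : ℝ) else 0 := by
  have ha : a ∉ Finset.univ.erase a := Finset.notMem_erase _ _
  match j with
  | 0 =>
    rw [pow_zero, one_mul, if_neg zero_ne_one]
    exact coeff_sum_X_pow_of_notMem ha _ (Finset.mem_univ a)
  | 1 =>
    rw [pow_one, coeff_X_mul_sum_single, if_pos (Finset.mem_univ a), if_pos rfl]
    have h := coeff_sum_X_pow_card (Finset.Subset.refl (Finset.univ.erase a))
    rwa [Finset.card_erase_of_mem (Finset.mem_univ a), Finset.card_univ] at h
  | j + 2 =>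
    rw [if_neg (by omega), pow_succ', pow_succ', mul_assoc, mul_assoc, coeff_X_mul_sum_single,
      if_pos (Finset.mem_univ a), coeff_X_mul_sum_single, if_neg ha]

end MultilinearCoefficient

section AreaMeasure

variable {n : ℕ}

/-- A form in three variables, restricted to the plane where the third variable vanishes, is a binary
form. -/
lemma exists_binary_form {m : ℕ} {R : MvPolynomial (Fin 3) ℝ} (hR : R.IsHomogeneous m) :
    ∃ c : Fin (m + 1) → ℝ, ∀ s l : ℝ,
      MvPolynomial.eval ![s, l, 0] R = ∑ j, c j * (l ^ (j : ℕ) * s ^ (m - j)) := by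
  refine ⟨fun j => R.coeff (Finsupp.single 0 (m - j) + Finsupp.single 1 (j : ℕ)), fun s l => ?_⟩
  rw [MvPolynomial.eval_eq']
  symm
  have hinj : Function.Injective fun j : Fin (m + 1) =>
      (Finsupp.single 0 (m - j) + Finsupp.single 1 (j : ℕ) : Fin 3 →₀ ℕ) := fun i j hij => by
    have := DFunLike.congr_fun hij 1
    simp at this
    exact Fin.ext this
  have h1 : ∑ j : Fin (m + 1), R.coeff (Finsupp.single 0 (m - j) + Finsupp.single 1 (j : ℕ)) *
      (l ^ (j : ℕ) * s ^ (m - j)) =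
      ∑ d ∈ Finset.univ.map ⟨_, hinj⟩, R.coeff d * ∏ i, ![s, l, 0] i ^ d i := by
    rw [Finset.sum_map]
    refine Finset.sum_congr rfl fun j _ => ?_
    simp [Fin.prod_univ_three, mul_comm]
  rw [h1]
  have h2 : ∀ d, d ∈ Finset.univ.map ⟨_, hinj⟩ ∪ R.support →
      d ∉ Finset.univ.map ⟨_, hinj⟩ → R.coeff d * ∏ i, ![s, l, 0] i ^ d i = 0 := fun d _ hd => by
    by_cases h0 : R.coeff d = 0
    · rw [h0, zero_mul]
    have hdeg : d 0 + d 1 + d 2 = m := by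
      have := hR h0
      rw [Finsupp.weight_apply, Finsupp.sum_fintype _ _ (by simp)] at this
      simpa [Fin.sum_univ_three] using this
    have hd2 : d 2 ≠ 0 := fun h2 => hd (by
      simp only [Finset.mem_map, Finset.mem_univ, true_and, Function.Embedding.coeFn_mk]
      refine ⟨⟨d 1, by omega⟩, ?_⟩
      ext i
      fin_cases i
      · simp; omega
      · simp
      · simp [h2])
    simp [Fin.prod_univ_three, hd2]
  rw [Finset.sum_subset Finset.subset_union_left h2]
  refine (Finset.sum_subset Finset.subset_union_right fun d _ hd => ?_).symm
  rw [MvPolynomial.notMem_support_iff.1 hd, zero_mul]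

/-- The coefficient functionals `T_j` in the expansion
`S_{n-1}(s B + l K) = ∑_j l^j s^{n-1-j} T_j`, obtained by inverting a Vandermonde system. -/
def areaCLM (K : Body n) (j : Fin (n - 1 + 1)) : C(Sph n, ℝ) →L[ℝ] ℝ :=
  ∑ k, (Matrix.vandermonde fun k : Fin (n - 1 + 1) => ((k : ℕ) : ℝ))⁻¹ j k •
    surfCLM ((1 : ℝ) • unitBall n + ((k : ℕ) : ℝ) • K)

lemma exists_firstVar_eq (K L : Body n) : ∃ c : Fin (n - 1 + 1) → ℝ, ∀ s l : ℝ, 0 ≤ s → 0 ≤ l →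
    firstVar (s • unitBall n + l • K) L = ∑ j, c j * (l ^ (j : ℕ) * s ^ (n - 1 - j)) := by
  obtain ⟨P, hhom, hP⟩ := exists_volume_polynomial ![unitBall n, K, L]
  obtain ⟨c, hc⟩ := exists_binary_form (hhom.pderiv (i := 2))
  refine ⟨c, fun s l hs hl => ?_⟩
  rw [← hc]
  have h := firstVar_comb hP (x := ![s, l, 0]) (v := ![0, 0, 1]) (by simp [Fin.forall_fin_succ, hs, hl])
    (by simp [Fin.forall_fin_succ])
  simpa only [Fin.sum_univ_three, Matrix.cons_val_zero, Matrix.cons_val_one, Matrix.cons_val,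
    one_smul, zero_smul_body, add_zero, zero_add, zero_mul, one_mul] using h

/-- On support functions, `T_j` takes the `j`-th coefficient of the first variation at `s B + l K`. -/
lemma areaCLM_suppC {K L : Body n} {c : Fin (n - 1 + 1) → ℝ} (hc : ∀ s l : ℝ, 0 ≤ s → 0 ≤ l →
    firstVar (s • unitBall n + l • K) L = ∑ j, c j * (l ^ (j : ℕ) * s ^ (n - 1 - j)))
    (j : Fin (n - 1 + 1)) : areaCLM K j (suppC L) = c j := by
  set V := Matrix.vandermonde fun k : Fin (n - 1 + 1) => ((k : ℕ) : ℝ) with hV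
  have hdet : IsUnit V.det := by
    rw [isUnit_iff_ne_zero, hV, Matrix.det_vandermonde_ne_zero_iff]
    exact fun a b hab => Fin.ext (Nat.cast_injective (R := ℝ) hab)
  have h1 : ∀ k : Fin (n - 1 + 1),
      firstVar ((1 : ℝ) • unitBall n + ((k : ℕ) : ℝ) • K) L = (V.mulVec c) k := fun k => by
    rw [hc 1 _ zero_le_one (Nat.cast_nonneg _), Matrix.mulVec, dotProduct]
    refine Finset.sum_congr rfl fun j _ => ?_
    rw [hV, Matrix.vandermonde_apply, one_pow, mul_one, mul_comm]
  have h2 : V⁻¹.mulVec (V.mulVec c) = c := by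
    rw [Matrix.mulVec_mulVec, Matrix.nonsing_inv_mul _ hdet, Matrix.one_mulVec]
  conv_rhs => rw [← h2]
  simp only [areaCLM, sum_apply, smul_apply, surfCLM_suppC, smul_eq_mul, h1]
  rfl

/-- The expansion `S_{n-1}(s B + l K) = ∑_j l^j s^{n-1-j} T_j`. It holds on support functions by the
homogeneity of the first variation, hence on all continuous functions by density. -/
lemma surfCLM_eq_sum (K : Body n) {s l : ℝ} (hs : 0 ≤ s) (hl : 0 ≤ l) :
    surfCLM (s • unitBall n + l • K) =
      ∑ j : Fin (n - 1 + 1), (l ^ (j : ℕ) * s ^ (n - 1 - j)) • areaCLM K j := by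
  refine clm_ext_suppC fun L => ?_
  obtain ⟨c, hc⟩ := exists_firstVar_eq K L
  simp only [sum_apply, smul_apply, surfCLM_suppC, smul_eq_mul, areaCLM_suppC hc, hc s l hs hl]
  exact Finset.sum_congr rfl fun j _ => mul_comm _ _

/-- The index `1` of the coefficient that is linear in the body. -/
abbrev oneIdx (hn : 2 ≤ n) : Fin (n - 1 + 1) := ⟨1, by omega⟩

lemma areaCLM_one_suppC (hn : 2 ≤ n) (K L : Body n) : areaCLM K (oneIdx hn) (suppC L) = mixVar K L := by
  obtain ⟨c, hc⟩ := exists_firstVar_eq K L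
  rw [areaCLM_suppC hc]
  have h : HasDerivAt (fun l : ℝ => ∑ j : Fin (n - 1 + 1), c j * l ^ (j : ℕ))
      (∑ j : Fin (n - 1 + 1), c j * ((j : ℕ) * (0 : ℝ) ^ ((j : ℕ) - 1))) 0 :=
    HasDerivAt.fun_sum fun j _ => (hasDerivAt_pow (j : ℕ) (0 : ℝ)).const_mul (c j)
  have h1 : ∑ j : Fin (n - 1 + 1), c j * ((j : ℕ) * (0 : ℝ) ^ ((j : ℕ) - 1)) = c (oneIdx hn) := by
    rw [Finset.sum_eq_single (oneIdx hn)]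
    · simp
    · intro j _ hj
      have hj1 : (j : ℕ) ≠ 1 := fun h => hj (Fin.ext h)
      rcases Nat.eq_zero_or_pos (j : ℕ) with h0 | h0
      · simp [h0]
      · rw [zero_pow (by omega), mul_zero, mul_zero]
    · simp
  rw [h1] at h
  symm
  refine HasDerivWithinAt.derivWithin ?_ (uniqueDiffOn_Ici 0 0 (by simp))
  refine h.hasDerivWithinAt.congr_of_mem (fun l hl => ?_) (by simp)
  have := hc 1 l zero_le_one hl
  simpa using this

/-- The functional `T_1` is positive, by the monotonicity of `mixVar`. -/
lemma areaCLM_one_nonneg (hn : 2 ≤ n) (K : Body n) {g : C(Sph n, ℝ)} (hg : ∀ u, 0 ≤ g u) :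
    0 ≤ areaCLM K (oneIdx hn) g :=
  clm_nonneg (fun L M h => by
    rw [areaCLM_one_suppC hn, areaCLM_one_suppC hn]
    exact mixVar_mono K (subset_of_supportFn_le h)) hg

/-- The combination `∑ l_i L_i` of `K` (for `i = 0`) and of balls (for `i > 0`). -/
lemma sum_smul_ite (K : Body n) {l : Fin (n - 1) → ℝ} (hl : ∀ i, 0 ≤ l i) (z : Fin (n - 1))
    (hz : (z : ℕ) = 0) :
    ∑ i, l i • (if (i : ℕ) < 1 then K else unitBall n) =
      (∑ i ∈ Finset.univ.erase z, l i) • unitBall n + l z • K := by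
  refine eq_of_supportFn_eq fun u => ?_
  rw [supportFn_body_sum _ _ _ fun i _ => hl i, supportFn_body_add, supportFn_body_smul _ (hl z),
    supportFn_body_smul _ (Finset.sum_nonneg fun i _ => hl i), ← Finset.add_sum_erase _ _
    (Finset.mem_univ z), add_comm, if_pos (by omega), Finset.sum_mul]
  congr 1
  refine Finset.sum_congr rfl fun i hi => ?_
  rw [if_neg]
  have : i ≠ z := Finset.ne_of_mem_erase hi
  exact fun h => this (Fin.ext (by omega))

/-- The polynomial describing `∫ g dS_{n-1}(∑ l_i L_i)` for `L = (K, B, …, B)`. -/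
def areaPoly (K : Body n) (g : C(Sph n, ℝ)) (z : Fin (n - 1)) : MvPolynomial (Fin (n - 1)) ℝ :=
  ∑ j : Fin (n - 1 + 1), MvPolynomial.C (areaCLM K j g) * (MvPolynomial.X z ^ (j : ℕ) *
    (∑ i ∈ Finset.univ.erase z, MvPolynomial.X i) ^ (n - 1 - j))

lemma eval_areaPoly (K : Body n) (g : C(Sph n, ℝ)) {z : Fin (n - 1)} (hz : (z : ℕ) = 0)
    {l : Fin (n - 1) → ℝ} (hl : ∀ i, 0 ≤ l i) :
    ∫ u, g u ∂(surfaceAreaMeasure (∑ i, l i • (if (i : ℕ) < 1 then K else unitBall n))) =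
      MvPolynomial.eval l (areaPoly K g z) := by
  rw [sum_smul_ite K hl z hz, ← intCLM_apply, ← surfCLM,
    surfCLM_eq_sum K (Finset.sum_nonneg fun i _ => hl i) (hl z)]
  simp only [areaPoly, sum_apply, smul_apply, smul_eq_mul, map_sum, map_mul, MvPolynomial.eval_C,
    map_pow, MvPolynomial.eval_X]
  exact Finset.sum_congr rfl fun j _ => mul_comm _ _

lemma coeff_areaPoly (hn : 2 ≤ n) (K : Body n) (g : C(Sph n, ℝ)) (z : Fin (n - 1)) :
    (areaPoly K g z).coeff (∑ i, Finsupp.single i 1) =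
      ((n - 1 - 1).factorial : ℝ) * areaCLM K (oneIdx hn) g := by
  have h := fun j => coeff_X_pow_mul_sum_X_pow z j
  simp only [Fintype.card_fin] at h
  rw [areaPoly, MvPolynomial.coeff_sum]
  simp only [MvPolynomial.coeff_C_mul, h]
  rw [Finset.sum_eq_single (oneIdx hn)]
  · simp [mul_comm]
  · intro j _ hj
    rw [if_neg fun h => hj (Fin.ext h), mul_zero]
  · simp

/-- The mixed area measures of `(K, B, …, B)` are the measures representing `T_1 / (n - 1)`. -/
lemma isMixedAreaMeasure_iff (hn : 2 ≤ n) (K : Body n) {m : Measure (Sph n)} :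
    IsMixedAreaMeasure (fun i : Fin (n - 1) => if (i : ℕ) < 1 then K else unitBall n) m ↔
      IsFiniteMeasure m ∧ ∀ g : C(Sph n, ℝ),
        ((n - 1 : ℕ) : ℝ) * ∫ u, g u ∂m = areaCLM K (oneIdx hn) g := by
  let z : Fin (n - 1) := ⟨0, by omega⟩
  have hfac : ((n - 1).factorial : ℝ) = ((n - 1 - 1).factorial : ℝ) * ((n - 1 : ℕ) : ℝ) := by
    rw [← Nat.mul_factorial_pred (n := n - 1) (by omega)]
    push_cast
    ring
  have h0 : ((n - 1 - 1).factorial : ℝ) ≠ 0 := Nat.cast_ne_zero.2 (Nat.factorial_ne_zero _)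
  refine and_congr_right fun _ => forall_congr' fun g => ?_
  constructor
  · rintro ⟨P, hP, hPc⟩
    -- a polynomial is determined by its values on the nonnegative orthant
    have hPP : P = areaPoly K g z :=
      MvPolynomial.funext_set (fun _ => Set.Ici (0 : ℝ)) (fun _ => Set.Ici_infinite 0)
        fun l hl => by
          have hl' : ∀ i, 0 ≤ l i := fun i => hl i (Set.mem_univ i)
          rw [← hP l hl', ← eval_areaPoly K g rfl hl']
    rw [hPP, coeff_areaPoly hn, hfac, mul_assoc] at hPc
    exact mul_left_cancel₀ h0 hPc
  · intro h
    refine ⟨areaPoly K g z, fun l hl => eval_areaPoly K g rfl hl, ?_⟩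
    rw [coeff_areaPoly hn, hfac, mul_assoc, h]

lemma exists_isMixedAreaMeasure (hn : 2 ≤ n) (K : Body n) : ∃ m,
    IsMixedAreaMeasure (fun i : Fin (n - 1) => if (i : ℕ) < 1 then K else unitBall n) m := by
  have h0 : (0 : ℝ) < ((n - 1 : ℕ) : ℝ) := Nat.cast_pos.2 (by omega)
  obtain ⟨m, hm, h⟩ := exists_measure_of_nonneg
    (((((n - 1 : ℕ) : ℝ)⁻¹ • areaCLM K (oneIdx hn) : C(Sph n, ℝ) →L[ℝ] ℝ) : C(Sph n, ℝ) →ₗ[ℝ] ℝ))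
    (fun g hg => mul_nonneg (inv_nonneg.2 h0.le) (areaCLM_one_nonneg hn K hg))
  refine ⟨m, (isMixedAreaMeasure_iff hn K).2 ⟨hm, fun g => ?_⟩⟩
  rw [h]
  simp [mul_inv_cancel_left₀ h0.ne']

lemma isMixedAreaMeasure_areaMeasure (hn : 2 ≤ n) (K : Body n) :
    IsMixedAreaMeasure (fun i : Fin (n - 1) => if (i : ℕ) < 1 then K else unitBall n)
      (areaMeasure 1 K) := by
  rw [areaMeasure, mixedAreaMeasure, dif_pos (exists_isMixedAreaMeasure hn K)]
  exact (exists_isMixedAreaMeasure hn K).choose_spec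

lemma isFiniteMeasure_areaMeasure (hn : 2 ≤ n) (K : Body n) : IsFiniteMeasure (areaMeasure 1 K) :=
  (isMixedAreaMeasure_areaMeasure hn K).1

lemma integral_areaMeasure (hn : 2 ≤ n) (K : Body n) (g : C(Sph n, ℝ)) :
    ((n - 1 : ℕ) : ℝ) * ∫ u, g u ∂(areaMeasure 1 K) = areaCLM K (oneIdx hn) g :=
  ((isMixedAreaMeasure_iff hn K).1 (isMixedAreaMeasure_areaMeasure hn K)).2 g

end AreaMeasure

/-! ### Dependence of the first area measure on the body -/

section BodyDependence

variable {n : ℕ}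

lemma firstVar_pointBody (Q : Body n) (x : E n) : firstVar Q (pointBody x) = 0 := by
  refine firstVar_eq_of_hasDerivWithinAt ?_
  have h : ∀ t : ℝ, vol (Q + t • pointBody x) = vol Q := fun t => by
    have hset : ((Q + t • pointBody x : Body n) : Set (E n)) = (fun y => y + t • x) '' Q := by
      change (Q : Set (E n)) + t • ({x} : Set (E n)) = _
      rw [Set.smul_set_singleton, Set.add_singleton]
    rw [vol, vol, hset, measureReal_def, measureReal_def, Set.image_add_right, measure_preimage_add_right]
  simp only [h]
  exact hasDerivWithinAt_const _ _ _

lemma mixVar_pointBody_right (K : Body n) (x : E n) : mixVar K (pointBody x) = 0 := by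
  rw [mixVar]
  simp only [firstVar_pointBody]
  exact (hasDerivWithinAt_const _ _ _).derivWithin (uniqueDiffOn_Ici (0 : ℝ) 0 (by simp))

lemma mixVar_pointBody_left (K : Body n) (x : E n) : mixVar (pointBody x) K = 0 := by
  rw [mixVar_comm, mixVar_pointBody_right]

variable (hn : 2 ≤ n)

lemma areaCLM_add (K L : Body n) :
    areaCLM (K + L) (oneIdx hn) = areaCLM K (oneIdx hn) + areaCLM L (oneIdx hn) :=
  clm_ext_suppC fun M => by
    rw [add_apply, areaCLM_one_suppC, areaCLM_one_suppC, areaCLM_one_suppC, mixVar_add_left]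

lemma areaCLM_smul (K : Body n) {t : ℝ} (ht : 0 ≤ t) :
    areaCLM (t • K) (oneIdx hn) = t • areaCLM K (oneIdx hn) :=
  clm_ext_suppC fun M => by
    rw [smul_apply, areaCLM_one_suppC, areaCLM_one_suppC, mixVar_smul_left _ _ ht, smul_eq_mul]

lemma areaCLM_pointBody (x : E n) : areaCLM (pointBody x) (oneIdx hn) = 0 :=
  clm_ext_suppC fun M => by
    rw [areaCLM_one_suppC, mixVar_pointBody_left, zero_apply]

lemma areaCLM_mono (K : Body n) {f g : C(Sph n, ℝ)} (h : ∀ u, f u ≤ g u) :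
    areaCLM K (oneIdx hn) f ≤ areaCLM K (oneIdx hn) g := by
  rw [← sub_nonneg, ← map_sub]
  exact areaCLM_one_nonneg hn K fun u => sub_nonneg.2 (h u)

lemma abs_areaCLM_le (K : Body n) (g : C(Sph n, ℝ)) :
    |areaCLM K (oneIdx hn) g| ≤ ‖g‖ * areaCLM K (oneIdx hn) 1 := by
  rw [abs_le, ← smul_eq_mul, ← map_smul, ← map_neg]
  constructor
  · refine areaCLM_mono hn K fun u => ?_
    simpa using (abs_le.1 (g.norm_coe_le_norm u)).1
  · refine areaCLM_mono hn K fun u => ?_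
    simpa using (abs_le.1 (g.norm_coe_le_norm u)).2

lemma continuous_suppC : Continuous (suppC (n := n)) := by
  refine (LipschitzWith.of_dist_le_mul (K := 1) fun K L => ?_).continuous
  rw [ContinuousMap.dist_le (by positivity)]
  intro u
  have := abs_supportFn_sub_le_dist K L u
  rw [norm_eq_of_mem_sphere, mul_one] at this
  simpa [Real.dist_eq] using this

lemma continuous_mixVar_left (hn : 2 ≤ n) (L : Body n) : Continuous fun K : Body n => mixVar K L := by
  simp only [fun K => mixVar_comm K L, ← areaCLM_one_suppC hn]
  exact (areaCLM L (oneIdx hn)).continuous.comp continuous_suppC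

/-- The first area measure depends continuously on the body, in the weak sense. For differences of
support functions this follows from the symmetry of `mixVar`, and the general case follows by
approximation, as the total mass `mixVar K B` is locally bounded. -/
lemma continuous_areaCLM (g : C(Sph n, ℝ)) :
    Continuous fun K : Body n => areaCLM K (oneIdx hn) g := by
  have hmass : ∀ K : Body n, areaCLM K (oneIdx hn) 1 = mixVar K (unitBall n) := fun K => by
    rw [← areaCLM_one_suppC hn, suppC_unitBall]
  rw [continuous_iff_continuousAt]
  intro K
  refine continuousAt_of_locally_uniform_approx_of_continuousAt fun U hU => ?_
  obtain ⟨ε, hε, hεU⟩ := Metric.mem_uniformity_dist.1 hU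
  set r : ℝ := mixVar K (unitBall n) + 1 with hr
  have hr0 : 0 < r := by
    have := areaCLM_one_nonneg hn K (g := 1) fun u => zero_le_one
    rw [hmass] at this
    linarith
  obtain ⟨v, ⟨L, M, rfl⟩, hv⟩ := dense_suppDiff.inter_nhds_nonempty
    (Metric.ball_mem_nhds g (show 0 < ε / r by positivity))
  refine ⟨{K' | mixVar K' (unitBall n) < r},
    (continuous_mixVar_left hn (unitBall n)).continuousAt.eventually (gt_mem_nhds (by linarith)),
    fun K' => mixVar K' L - mixVar K' M,
    ((continuous_mixVar_left hn L).sub (continuous_mixVar_left hn M)).continuousAt,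
    fun K' hK' => hεU ?_⟩
  simp only
  rw [← areaCLM_one_suppC hn, ← areaCLM_one_suppC hn, ← map_sub, Real.dist_eq, ← map_sub]
  refine (abs_areaCLM_le hn K' _).trans_lt ?_
  rw [hmass, ← dist_eq_norm]
  rw [Metric.mem_ball, dist_comm] at hv
  have h0 : 0 ≤ mixVar K' (unitBall n) := by
    rw [← hmass]
    exact areaCLM_one_nonneg hn K' fun u => zero_le_one
  calc _ ≤ dist g (suppC L - suppC M) * r := by
        gcongr
        exact hK'.le
    _ < ε / r * r := by gcongr
    _ = ε := by field_simp

/-- If the union of two convex bodies is convex, then its Minkowski sum with the intersection is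
the sum of the two bodies. -/
lemma add_eq_union_add_inter {K L U I : Body n} (hU : (U : Set (E n)) = (K : Set (E n)) ∪ L)
    (hI : (I : Set (E n)) = (K : Set (E n)) ∩ L) : K + L = U + I := by
  refine ConvexBody.ext (Set.Subset.antisymm ?_ ?_)
  · rintro _ ⟨x, hx, y, hy, rfl⟩
    -- the segment from `x` to `y` is connected, so it meets `K ∩ L`
    have hseg : segment ℝ x y ⊆ (K : Set (E n)) ∪ L := by
      rw [← hU]
      exact U.convex.segment_subset (by rw [hU]; exact Or.inl hx) (by rw [hU]; exact Or.inr hy)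
    have hconn := isPreconnected_closed_iff.1 (convex_segment (𝕜 := ℝ) x y).isPreconnected _ _
      K.isClosed L.isClosed hseg ⟨x, left_mem_segment ℝ x y, hx⟩ ⟨y, right_mem_segment ℝ x y, hy⟩
    obtain ⟨z, hz, hzKL⟩ := hconn
    obtain ⟨a, b, ha, hb, hab, rfl⟩ := hz
    refine ⟨b • x + a • y, ?_, a • x + b • y, (by rw [hI]; exact hzKL), ?_⟩
    · rw [hU]
      exact hseg ⟨b, a, hb, ha, by rw [add_comm, hab], rfl⟩
    · change b • x + a • y + (a • x + b • y) = x + y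
      rw [show b • x + a • y + (a • x + b • y) = (a + b) • x + (a + b) • y by module, hab,
        one_smul, one_smul]
  · rintro _ ⟨x, hx, y, hy, rfl⟩
    rw [hU] at hx
    rw [hI] at hy
    rcases hx with hx | hx
    · exact Set.add_mem_add hx hy.2
    · exact ⟨y, hy.1, x, hx, add_comm y x⟩

/-- Integration of a fixed continuous function against the first area measure is a valuation in
`Val_1`. -/
theorem isVal_integral_areaMeasure (g : C(Sph n, ℝ)) {μ : Body n → ℝ}
    (hμ : ∀ K, ((n - 1 : ℕ) : ℝ) * μ K = areaCLM K (oneIdx hn) g) : IsVal 1 μ := by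
  have h0 : ((n - 1 : ℕ) : ℝ) ≠ 0 := Nat.cast_ne_zero.2 (by omega)
  have hμ' : ∀ K, μ K = ((n - 1 : ℕ) : ℝ)⁻¹ * areaCLM K (oneIdx hn) g := fun K => by
    rw [← hμ, inv_mul_cancel_left₀ h0]
  refine ⟨fun K L U I hU hI => ?_, ?_, fun K x => ?_, fun K t ht => ?_⟩
  · simp only [hμ', ← mul_add, ← add_apply, ← areaCLM_add, add_eq_union_add_inter hU hI]
  · simp only [funext hμ']
    exact (continuous_areaCLM hn g).const_mul _
  · rw [hμ', hμ', areaCLM_add, areaCLM_pointBody, add_zero]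
  · rw [hμ', hμ', areaCLM_smul hn K ht, smul_apply, smul_eq_mul, pow_one]
    ring

end BodyDependence

/-! ### The first area measure of a segment -/

section Segment

variable {n : ℕ}

/-- Linear growth: `A + (m + 1) [0, v]` is covered by `A + m [0, v]` and the translate of `A + [0, v]`
by `m v`. -/
lemma vol_add_segBody_le (A : Body n) (v : E n) (m : ℕ) :
    vol (A + (m : ℝ) • segBody v) ≤ m * vol (A + segBody v) + vol A := by
  induction m with
  | zero => simp [zero_smul_body]
  | succ m ih =>
    set T : Set (E n) := (fun y => y + (m : ℝ) • v) '' ((A + segBody v : Body n) : Set (E n)) with hT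
    have hcov : ((A + ((m + 1 : ℕ) : ℝ) • segBody v : Body n) : Set (E n)) ⊆
        ((A + (m : ℝ) • segBody v : Body n) : Set (E n)) ∪ T := by
      rintro _ ⟨a, ha, _, ⟨y, hy, rfl⟩, rfl⟩
      obtain ⟨t, h0, h1, rfl⟩ := mem_segBody.1 hy
      simp only
      push_cast
      have hm0 : (0 : ℝ) ≤ m := Nat.cast_nonneg m
      by_cases hle : (m + 1) * t ≤ m
      · left
        rcases hm0.eq_or_lt with hm | hm
        · have : t = 0 := by rw [← hm] at hle; linarith
          refine ⟨a, ha, (m : ℝ) • (0 : ℝ) • v, Set.smul_mem_smul_set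
            (mem_segBody.2 ⟨0, le_rfl, zero_le_one, rfl⟩), ?_⟩
          simp [this]
        · refine ⟨a, ha, (m : ℝ) • ((m + 1) * t / m) • v, Set.smul_mem_smul_set
            (mem_segBody.2 ⟨(m + 1) * t / m, by positivity, by rwa [div_le_one hm], rfl⟩), ?_⟩
          simp only [smul_smul]
          congr 2
          field_simp
      · right
        refine ⟨a + ((m + 1) * t - m) • v, Set.add_mem_add ha
          (mem_segBody.2 ⟨(m + 1) * t - m, by linarith, by nlinarith, rfl⟩), ?_⟩
        simp only
        module
    have hTvol : (volume : Measure (E n)).real T = vol (A + segBody v) := by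
      rw [vol, measureReal_def, measureReal_def, hT, Set.image_add_right,
        measure_preimage_add_right]
    have hfin : (volume : Measure (E n)) T ≠ ⊤ := by
      rw [hT, Set.image_add_right, measure_preimage_add_right]
      exact (ConvexBody.isCompact _).measure_lt_top.ne
    have h1 : vol (A + ((m + 1 : ℕ) : ℝ) • segBody v) ≤
        vol (A + (m : ℝ) • segBody v) + (volume : Measure (E n)).real T :=
      (measureReal_mono hcov (measure_union_lt_top (ConvexBody.isCompact _).measure_lt_top
        hfin.lt_top).ne).trans (measureReal_union_le _ _)
    rw [hTvol] at h1
    push_cast at h1 ⊢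
    linarith

lemma eval_aeval_C_X (P : MvPolynomial (Fin 2) ℝ) (a s : ℝ) :
    (MvPolynomial.aeval ![Polynomial.C a, Polynomial.X] P : Polynomial ℝ).eval s =
      MvPolynomial.eval ![a, s] P := by
  induction P using MvPolynomial.induction_on with
  | C r => simp
  | add p q hp hq => simp [hp, hq]
  | mul_X p i hp =>
    rw [map_mul, map_mul, Polynomial.eval_mul, hp, MvPolynomial.aeval_X, MvPolynomial.eval_X]
    fin_cases i <;> simp

/-- The volume of `A + s [0, v]` is affine in `s`, being a polynomial of at most linear growth. -/
lemma exists_vol_add_smul_segBody (A : Body n) (v : E n) :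
    ∃ b, ∀ s : ℝ, 0 ≤ s → vol (A + s • segBody v) = vol A + b * s := by
  obtain ⟨P, -, hP⟩ := exists_volume_polynomial ![A, segBody v]
  set q : Polynomial ℝ := MvPolynomial.aeval ![Polynomial.C (1 : ℝ), Polynomial.X] P with hq
  have hqe : ∀ s : ℝ, 0 ≤ s → vol (A + s • segBody v) = q.eval s := fun s hs => by
    have h := hP ![1, s] (by simp [Fin.forall_fin_two, hs])
    simp only [Fin.sum_univ_two, Matrix.cons_val_zero, Matrix.cons_val_one, one_smul] at h
    rw [vol, h, hq, eval_aeval_C_X]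
  have hdeg : q.degree ≤ 1 := by
    by_contra hgt
    have hlim := Polynomial.abs_div_tendsto_atTop_atTop_of_degree_gt q Polynomial.X
      (by rw [Polynomial.degree_X]; exact not_le.1 hgt) Polynomial.X_ne_zero
    have hlim2 := hlim.comp tendsto_natCast_atTop_atTop
    obtain ⟨m, hm, hm1⟩ := ((hlim2.eventually_gt_atTop
      (vol (A + segBody v) + vol A)).and (Filter.eventually_ge_atTop 1)).exists
    have hm0 : (0 : ℝ) < m := Nat.cast_pos.2 hm1
    have h1 : (1 : ℝ) ≤ m := Nat.one_le_cast.2 hm1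
    have hA : 0 ≤ vol A := measureReal_nonneg
    simp only [Function.comp_apply, Polynomial.eval_X] at hm
    have hv : 0 ≤ vol (A + (m : ℝ) • segBody v) := measureReal_nonneg
    rw [← hqe _ hm0.le, abs_of_nonneg (div_nonneg hv hm0.le), lt_div_iff₀ hm0] at hm
    have := vol_add_segBody_le A v m
    nlinarith
  rw [Polynomial.eq_X_add_C_of_degree_le_one hdeg] at hqe
  have h0 := hqe 0 le_rfl
  refine ⟨q.coeff 1, fun s hs => ?_⟩
  rw [hqe s hs]
  simp [zero_smul_body] at h0 ⊢
  rw [h0]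
  ring

lemma firstVar_add_smul_segBody (A : Body n) (v : E n) {l : ℝ} (hl : 0 ≤ l) :
    firstVar (A + l • segBody v) (segBody v) = vol (A + segBody v) - vol A := by
  obtain ⟨b, hb⟩ := exists_vol_add_smul_segBody A v
  have h1 := hb 1 zero_le_one
  rw [one_smul, mul_one] at h1
  rw [h1, add_sub_cancel_left]
  refine firstVar_eq_of_hasDerivWithinAt ?_
  have h : HasDerivAt (fun t : ℝ => vol A + b * (l + t)) b 0 := by
    simpa using (((hasDerivAt_id (0 : ℝ)).const_add l).const_mul b).const_add (vol A)
  refine h.hasDerivWithinAt.congr_of_mem (fun t ht => ?_) (by simp)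
  have ht' : (0 : ℝ) ≤ t := ht
  rw [add_assoc, ← add_smul_body _ hl ht', hb _ (add_nonneg hl ht')]

lemma mixVar_segBody_self (v : E n) : mixVar (segBody v) (segBody v) = 0 := by
  have h := hasDerivWithinAt_const (0 : ℝ) (Set.Ici (0 : ℝ))
    (vol (unitBall n + segBody v) - vol (unitBall n))
  refine HasDerivWithinAt.derivWithin ?_ (uniqueDiffOn_Ici (0 : ℝ) 0 (by simp))
  refine h.congr_of_mem (fun l hl => ?_) (by simp)
  exact firstVar_add_smul_segBody _ _ hl

lemma segBody_neg (v : E n) : segBody (-v) = segBody v + pointBody (-v) :=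
  eq_of_supportFn_eq fun u => by
    rw [supportFn_body_add, supportFn_segBody, supportFn_segBody, supportFn_pointBody,
      inner_neg_right, max_def, max_def]
    split_ifs <;> linarith

/-- The function `u ↦ |⟨u, w⟩|` on the sphere. -/
def absInner (w : E n) : C(Sph n, ℝ) := ⟨fun u => |inner ℝ (u : E n) w|, by fun_prop⟩

@[simp] lemma absInner_apply (w : E n) (u : Sph n) : absInner w u = |inner ℝ (u : E n) w| := rfl

lemma absInner_eq (w : E n) : absInner w = suppC (segBody w + segBody (-w)) := by
  ext u
  rw [absInner_apply, suppC_apply, supportFn_body_add, supportFn_segBody, supportFn_segBody,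
    inner_neg_right]
  rcases le_total 0 (inner ℝ (u : E n) w) with h | h
  · rw [abs_of_nonneg h, max_eq_right h, max_eq_left (by linarith), add_zero]
  · rw [abs_of_nonpos h, max_eq_left h, max_eq_right (by linarith), zero_add]

variable (hn : 2 ≤ n)

lemma areaCLM_absInner (K : Body n) (w : E n) :
    areaCLM K (oneIdx hn) (absInner w) = 2 * mixVar K (segBody w) := by
  rw [absInner_eq, areaCLM_one_suppC, mixVar_add_right, segBody_neg, mixVar_add_right,
    mixVar_pointBody_right]
  ring

lemma areaCLM_segBody_absInner_self (v : E n) :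
    areaCLM (segBody v) (oneIdx hn) (absInner v) = 0 := by
  rw [areaCLM_absInner, mixVar_segBody_self, mul_zero]

/-- For segments, the symmetry of the mixed variation exchanges the directions. -/
lemma areaCLM_segBody_absInner_comm (v w : E n) :
    areaCLM (segBody v) (oneIdx hn) (absInner w) = areaCLM (segBody w) (oneIdx hn) (absInner v) := by
  rw [areaCLM_absInner, areaCLM_absInner, mixVar_comm]

/-- The first variation at `(1 + l) B` is `(1 + l)^{n-1}` times the one at `B`. -/
lemma mixVar_unitBall (L : Body n) :
    mixVar (unitBall n) L = ((n - 1 : ℕ) : ℝ) * firstVar (unitBall n) L := by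
  obtain ⟨c, hc⟩ := exists_firstVar_eq L L
  have hs : ∀ s : ℝ, 0 ≤ s → firstVar (s • unitBall n) L = c 0 * s ^ (n - 1) := fun s hs => by
    have h := hc s 0 hs le_rfl
    rw [zero_smul_body, add_zero, Finset.sum_eq_single 0] at h
    · simpa using h
    · intro j _ hj
      have : (j : ℕ) ≠ 0 := fun h => hj (Fin.ext h)
      rw [zero_pow this, zero_mul, mul_zero]
    · simp
  have h1 := hs 1 zero_le_one
  rw [one_smul, one_pow, mul_one] at h1
  rw [h1]
  have h : HasDerivAt (fun l : ℝ => c 0 * (1 + l) ^ (n - 1)) (((n - 1 : ℕ) : ℝ) * c 0) 0 := by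
    have := (((hasDerivAt_id (0 : ℝ)).const_add 1).pow (n - 1)).const_mul (c 0)
    refine this.congr_deriv ?_
    simp
    ring
  refine HasDerivWithinAt.derivWithin ?_ (uniqueDiffOn_Ici (0 : ℝ) 0 (by simp))
  refine h.hasDerivWithinAt.congr_of_mem (fun l hl => ?_) (by simp)
  have hl' : (0 : ℝ) ≤ l := hl
  rw [← hs _ (by linarith), add_smul_body _ zero_le_one hl', one_smul]

lemma vol_lt_vol_add_segBody {e : E n} (he : ‖e‖ = 1) :
    vol (unitBall n) < vol (unitBall n + segBody e) := by
  set p : E n := (3 / 2 : ℝ) • e with hp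
  have hball : Metric.ball p (1 / 2) ⊆
      ((unitBall n + segBody e : Body n) : Set (E n)) \ unitBall n := by
    intro x hx
    rw [Metric.mem_ball, dist_eq_norm] at hx
    refine ⟨⟨x - e, mem_unitBall.2 ?_, e, mem_segBody.2 ⟨1, zero_le_one, le_rfl, by simp⟩,
      sub_add_cancel x e⟩, fun hxB => ?_⟩
    · have h : x - e = (x - p) + (1 / 2 : ℝ) • e := by rw [hp]; module
      have h2 := norm_add_le (x - p) ((1 / 2 : ℝ) • e)
      rw [← h, norm_smul, he] at h2
      norm_num at h2
      linarith
    · have h1 := mem_unitBall.1 hxB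
      have h2 := norm_sub_norm_le p x
      rw [norm_sub_rev, hp, norm_smul, he] at h2
      norm_num at h2
      linarith
  have h1 : 0 < (volume : Measure (E n)).real (Metric.ball p (1 / 2)) :=
    ENNReal.toReal_pos (Metric.measure_ball_pos _ _ (by norm_num)).ne' measure_ball_lt_top.ne
  have hsub : (unitBall n : Set (E n)) ⊆ ((unitBall n + segBody e : Body n) : Set (E n)) :=
    fun x hx => ⟨x, hx, 0, mem_segBody.2 ⟨0, le_rfl, zero_le_one, by simp⟩, add_zero x⟩
  have h2 := measureReal_mono (μ := (volume : Measure (E n))) hball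
    ((measure_mono Set.sdiff_subset).trans_lt (ConvexBody.isCompact _).measure_lt_top).ne
  rw [measureReal_sdiff hsub (ConvexBody.isClosed _).measurableSet
    (ConvexBody.isCompact _).measure_lt_top.ne] at h2
  exact sub_pos.1 (h1.trans_le h2)

/-- The total mass of the first area measure of `[0, e]` is positive: by symmetry it is a multiple of
the first variation of the volume of the ball in the direction of `[0, e]`, which is the volume of
`(B + [0, e]) \ B`. -/
lemma areaCLM_segBody_one_pos {e : E n} (he : ‖e‖ = 1) : 0 < areaCLM (segBody e) (oneIdx hn) 1 := by
  rw [← suppC_unitBall, areaCLM_one_suppC, mixVar_comm, mixVar_unitBall]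
  have h := firstVar_add_smul_segBody (unitBall n) e le_rfl
  rw [zero_smul_body, add_zero] at h
  rw [h]
  exact mul_pos (Nat.cast_pos.2 (by omega)) (sub_pos.2 (vol_lt_vol_add_segBody he))

lemma inner_stdVec (u : E n) (i : Fin n) : inner ℝ u (stdVec i) = u i := by
  rw [real_inner_comm, EuclideanSpace.basisFun_inner]

/-- The area measure of the segment `[0, e_i]` does not vanish, and it is concentrated on the
hyperplane orthogonal to `e_i`; hence some other coordinate is not zero almost everywhere. -/
lemma exists_areaCLM_absInner_pos (i : Fin n) :
    ∃ j, 0 < areaCLM (segBody (stdVec i)) (oneIdx hn) (absInner (stdVec j)) := by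
  have h1 : areaCLM (segBody (stdVec i)) (oneIdx hn) 1 ≤
      areaCLM (segBody (stdVec i)) (oneIdx hn) (∑ j, absInner (stdVec j)) := by
    refine areaCLM_mono hn _ fun u => ?_
    rw [ContinuousMap.sum_apply, ContinuousMap.one_apply]
    simp only [absInner_apply, inner_stdVec]
    have hu : ∑ j, (u : E n) j ^ 2 = 1 := by
      rw [← EuclideanSpace.real_norm_sq_eq, norm_eq_of_mem_sphere, one_pow]
    refine hu.symm.le.trans ?_
    refine Finset.sum_le_sum fun j _ => ?_
    have hj : |(u : E n) j| ≤ 1 := by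
      rw [← Real.norm_eq_abs]
      exact (PiLp.norm_apply_le _ _).trans_eq (norm_eq_of_mem_sphere u)
    rw [← sq_abs]
    nlinarith [abs_nonneg ((u : E n) j)]
  have h2 := (areaCLM_segBody_one_pos hn (e := stdVec i) (by simp)).trans_le h1
  rw [map_sum] at h2
  obtain ⟨j, -, hj⟩ := Finset.exists_lt_of_sum_lt (s := Finset.univ) (f := fun _ => (0 : ℝ))
    (g := fun j => areaCLM (segBody (stdVec i)) (oneIdx hn) (absInner (stdVec j)))
    (by rwa [Finset.sum_const_zero])
  exact ⟨j, hj⟩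

end Segment

/-! ### The square root profile -/

section Profile

variable {n : ℕ} {ψ : ℝ → ℝ}

lemma continuousOn_profile (n : ℕ) (hψ : ContinuousOn ψ (Set.Icc (-1) 1))
    (hψ_zero : ∀ t ∈ Set.Icc (-1 : ℝ) 1, 2 / 3 ≤ |t| → ψ t = 0) :
    ContinuousOn (profile n ψ) (Set.Icc (-1) 1) := by
  intro t ht
  by_cases h : |t| < 1
  · have h1 : (1 : ℝ) - t ^ 2 ≠ 0 := by
      have := (sq_lt_one_iff_abs_lt_one t).2 h
      linarith
    refine ContinuousWithinAt.mul ?_ (hψ t ht)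
    refine (ContinuousAt.mul (by fun_prop) ?_).continuousWithinAt
    exact ContinuousAt.rpow_const (by fun_prop) (Or.inl h1)
  · -- the profile vanishes near the poles
    have hev : ∀ᶠ s in nhdsWithin t (Set.Icc (-1) 1), profile n ψ s = 0 := by
      have h2 : ∀ᶠ s in nhdsWithin t (Set.Icc (-1) 1), 2 / 3 < |s| :=
        (continuous_abs.continuousAt.eventually (lt_mem_nhds (by linarith [not_lt.1 h]))).filter_mono
          nhdsWithin_le_nhds
      filter_upwards [h2, self_mem_nhdsWithin] with s hs hsI
      rw [profile, hψ_zero s hsI hs.le, mul_zero]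
    have h0 : profile n ψ t = 0 := by
      rw [profile, hψ_zero t ht (by linarith [not_lt.1 h]), mul_zero]
    refine ContinuousWithinAt.congr_of_eventuallyEq (f := fun _ => (0 : ℝ))
      continuousWithinAt_const hev h0

lemma coord_mem_Icc (u : Sph n) (i : Fin n) : (u : E n) i ∈ Set.Icc (-1 : ℝ) 1 := by
  rw [Set.mem_Icc, ← abs_le, ← Real.norm_eq_abs]
  exact (PiLp.norm_apply_le _ _).trans_eq (norm_eq_of_mem_sphere u)

/-- The zonal function `u ↦ f(u_i)` on the sphere, where `f` is the profile. -/
def profileC (hψ : ContinuousOn ψ (Set.Icc (-1) 1))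
    (hψ_zero : ∀ t ∈ Set.Icc (-1 : ℝ) 1, 2 / 3 ≤ |t| → ψ t = 0) (i : Fin n) : C(Sph n, ℝ) :=
  ⟨fun u => profile n ψ ((u : E n) i),
    (continuousOn_profile n hψ hψ_zero).comp_continuous
      (f := fun u : Sph n => (u : E n) i) (by fun_prop) fun u => coord_mem_Icc u i⟩

/-- Near the equator the profile is at least a multiple of `√|t|`, hence on `[-δ², δ²]` at least a
multiple of `|t| / δ`. -/
lemma le_profile (n : ℕ) (hn : 2 ≤ n) (hψ_one : ∀ t ∈ Set.Icc (-1 : ℝ) 1, |t| ≤ 1 / 3 → ψ t = 1)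
    {δ t : ℝ} (hδ : 0 < δ) (hδ2 : δ ≤ 1 / 2) (ht : |t| ≤ δ ^ 2) :
    |t| / (2 * δ) ≤ profile n ψ t := by
  have hδ3 : δ ^ 2 ≤ 1 / 4 := by nlinarith
  have ht1 : |t| ≤ 1 := by linarith
  rw [profile, hψ_one t (abs_le.1 ht1) (by linarith), mul_one]
  have hsq : t ^ 2 ≤ 1 / 4 := by
    rw [← sq_abs]
    nlinarith [abs_nonneg t]
  have h1 : (1 : ℝ) / 2 ≤ (1 - t ^ 2) ^ (-(((n : ℝ) - 3) / 2)) := by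
    have hn' : (2 : ℝ) ≤ n := by exact_mod_cast hn
    have h := Real.rpow_le_rpow_of_exponent_ge (x := 1 - t ^ 2) (by linarith)
      (by linarith [sq_nonneg t]) (show -(((n : ℝ) - 3) / 2) ≤ 1 by linarith)
    rw [Real.rpow_one] at h
    linarith
  have h2 : |t| / δ ≤ Real.sqrt |t| := by
    rw [div_le_iff₀ hδ]
    have h3 : Real.sqrt |t| ≤ δ := by
      rw [Real.sqrt_le_left hδ.le]
      exact ht
    calc |t| = Real.sqrt |t| * Real.sqrt |t| := (Real.mul_self_sqrt (abs_nonneg t)).symm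
      _ ≤ _ := mul_le_mul_of_nonneg_left h3 (Real.sqrt_nonneg _)
  calc |t| / (2 * δ) = |t| / δ * (1 / 2) := by field_simp
    _ ≤ _ := mul_le_mul h2 h1 (by norm_num) (Real.sqrt_nonneg _)

end Profile

section Segments

variable {n : ℕ}

/-- The first area measure of a segment is concentrated on the orthogonal hyperplane. -/
lemma ae_inner_eq_zero (hn : 2 ≤ n) (v : E n) :
    ∀ᵐ u : Sph n ∂(areaMeasure 1 (segBody v)), inner ℝ (u : E n) v = 0 := by
  have := isFiniteMeasure_areaMeasure hn (segBody v)
  have h := integral_areaMeasure hn (segBody v) (absInner v)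
  rw [areaCLM_segBody_absInner_self, mul_eq_zero, or_iff_right (Nat.cast_ne_zero.2 (by omega)),
    integral_eq_zero_iff_of_nonneg (fun u => show 0 ≤ absInner v u from abs_nonneg _)
    ((absInner v).continuous.integrable_of_hasCompactSupport
      (HasCompactSupport.of_compactSpace _))] at h
  filter_upwards [h] with u hu
  exact abs_eq_zero.1 hu

/-- Inequalities that hold on the hyperplane `v^⊥` can be integrated against the first area
measure of the segment `[0, v]`. -/
lemma areaCLM_segBody_mono (hn : 2 ≤ n) {v : E n} {f g : C(Sph n, ℝ)}
    (h : ∀ u : Sph n, inner ℝ (u : E n) v = 0 → f u ≤ g u) :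
    areaCLM (segBody v) (oneIdx hn) f ≤ areaCLM (segBody v) (oneIdx hn) g := by
  have := isFiniteMeasure_areaMeasure hn (segBody v)
  rw [← integral_areaMeasure, ← integral_areaMeasure]
  refine mul_le_mul_of_nonneg_left (integral_mono_ae
    (f.continuous.integrable_of_hasCompactSupport (HasCompactSupport.of_compactSpace _))
    (g.continuous.integrable_of_hasCompactSupport (HasCompactSupport.of_compactSpace _)) ?_)
    (Nat.cast_nonneg _)
  filter_upwards [ae_inner_eq_zero hn v] with u hu using h u hu

lemma abs_supportFn_segBody_sub_le (v w : E n) (u : Sph n) :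
    |supportFn (segBody v) u - supportFn (segBody w) u| ≤ ‖v - w‖ := by
  rw [supportFn_segBody, supportFn_segBody]
  refine (abs_max_sub_max_le_max _ _ _ _).trans ?_
  rw [sub_zero, abs_zero, max_eq_right (abs_nonneg _), ← inner_sub_right]
  refine (abs_real_inner_le_norm _ _).trans_eq ?_
  rw [norm_eq_of_mem_sphere, one_mul]

/-- Tilting the segment `[0, e_i]` to `[0, e_i + δ² e_j]` changes it by at most `δ²`, but changes
the integral of the profile against the first area measure by at least a multiple of `δ`. -/
lemma tilt_le_areaCLM_profile (hn : 2 ≤ n) {ψ : ℝ → ℝ} (hψ : ContinuousOn ψ (Set.Icc (-1) 1))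
    (hψ_zero : ∀ t ∈ Set.Icc (-1 : ℝ) 1, 2 / 3 ≤ |t| → ψ t = 0)
    (hψ_one : ∀ t ∈ Set.Icc (-1 : ℝ) 1, |t| ≤ 1 / 3 → ψ t = 1) (i j : Fin n)
    {δ : ℝ} (hδ : 0 < δ) (hδ2 : δ ≤ 1 / 2) :
    δ / 2 * areaCLM (segBody (stdVec i)) (oneIdx hn) (absInner (stdVec j)) ≤
      areaCLM (segBody (stdVec i + δ ^ 2 • stdVec j)) (oneIdx hn) (profileC hψ hψ_zero i) := by
  set v := stdVec i + δ ^ 2 • stdVec j with hv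
  have hinner : ∀ u : Sph n, inner ℝ (u : E n) v = (u : E n) i + δ ^ 2 * (u : E n) j := fun u => by
    rw [hv, inner_add_right, real_inner_smul_right, inner_stdVec, inner_stdVec]
  have h1 : δ ^ 2 * areaCLM (segBody (stdVec i)) (oneIdx hn) (absInner (stdVec j)) ≤
      areaCLM (segBody v) (oneIdx hn) (absInner (stdVec i)) := by
    rw [areaCLM_segBody_absInner_comm hn v, ← smul_eq_mul, ← map_smul]
    refine areaCLM_segBody_mono hn fun u hu => ?_
    rw [inner_stdVec] at hu
    rw [ContinuousMap.smul_apply, absInner_apply, absInner_apply, hinner, inner_stdVec, hu,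
      zero_add, abs_mul, abs_of_nonneg (sq_nonneg δ), smul_eq_mul]
  have h2 : (1 / (2 * δ)) * areaCLM (segBody v) (oneIdx hn) (absInner (stdVec i)) ≤
      areaCLM (segBody v) (oneIdx hn) (profileC hψ hψ_zero i) := by
    rw [← smul_eq_mul, ← map_smul]
    refine areaCLM_segBody_mono hn fun u hu => ?_
    rw [ContinuousMap.smul_apply, absInner_apply, inner_stdVec, smul_eq_mul, one_div_mul_eq_div]
    refine le_profile n hn hψ_one hδ hδ2 ?_
    rw [hinner] at hu
    rw [eq_neg_of_add_eq_zero_left hu, abs_neg, abs_mul, abs_of_nonneg (sq_nonneg δ)]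
    have := abs_le.2 (coord_mem_Icc u j)
    nlinarith [sq_nonneg δ]
  calc δ / 2 * areaCLM (segBody (stdVec i)) (oneIdx hn) (absInner (stdVec j)) =
      1 / (2 * δ) * (δ ^ 2 * areaCLM (segBody (stdVec i)) (oneIdx hn) (absInner (stdVec j))) := by
        field_simp
    _ ≤ 1 / (2 * δ) * areaCLM (segBody v) (oneIdx hn) (absInner (stdVec i)) := by gcongr
    _ ≤ _ := h2

lemma areaCLM_profile_stdVec (hn : 2 ≤ n) {ψ : ℝ → ℝ} (hψ : ContinuousOn ψ (Set.Icc (-1) 1))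
    (hψ_zero : ∀ t ∈ Set.Icc (-1 : ℝ) 1, 2 / 3 ≤ |t| → ψ t = 0) (i : Fin n) :
    areaCLM (segBody (stdVec i)) (oneIdx hn) (profileC hψ hψ_zero i) = 0 := by
  have h0 : ∀ u : Sph n, inner ℝ (u : E n) (stdVec i) = 0 → profileC hψ hψ_zero i u = 0 :=
    fun u hu => by
      rw [inner_stdVec] at hu
      change profile n ψ ((u : E n) i) = 0
      rw [hu, profile, abs_zero, Real.sqrt_zero, zero_mul, zero_mul]
  rw [← map_zero (areaCLM (segBody (stdVec i)) (oneIdx hn))]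
  exact le_antisymm (areaCLM_segBody_mono hn fun u hu => (h0 u hu).le)
    (areaCLM_segBody_mono hn fun u hu => (h0 u hu).ge)

/-- The segments `δ⁻² [0, e_i + δ² e_j]` and `δ⁻² [0, e_i]` have support functions at distance at most
`1`, but the values of the functional on them differ by at least a multiple of `δ⁻¹`. -/
theorem not_isUniformlyContinuous_profile (hn : 2 ≤ n) {ψ : ℝ → ℝ} (hψ : ContinuousOn ψ (Set.Icc (-1) 1))
    (hψ_zero : ∀ t ∈ Set.Icc (-1 : ℝ) 1, 2 / 3 ≤ |t| → ψ t = 0)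
    (hψ_one : ∀ t ∈ Set.Icc (-1 : ℝ) 1, |t| ≤ 1 / 3 → ψ t = 1) (i : Fin n) {μ : Body n → ℝ}
    (hμ : ∀ K, ((n - 1 : ℕ) : ℝ) * μ K = areaCLM K (oneIdx hn) (profileC hψ hψ_zero i)) :
    ¬ IsUniformlyContinuous μ := by
  rintro ⟨C, hC⟩
  obtain ⟨j, hj⟩ := exists_areaCLM_absInner_pos hn i
  set N := areaCLM (segBody (stdVec i)) (oneIdx hn) (absInner (stdVec j)) with hN
  have hn0 : (0 : ℝ) < ((n - 1 : ℕ) : ℝ) := Nat.cast_pos.2 (by omega)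
  -- the two segments, scaled by `δ⁻²`, are at distance at most one
  have key : ∀ δ : ℝ, 0 < δ → δ ≤ 1 / 2 → N / 2 ≤ ((n - 1 : ℕ) : ℝ) * |C| * δ := by
    intro δ hδ hδ2
    have hinv : 0 ≤ (δ ^ 2)⁻¹ := by positivity
    have h := hC ((δ ^ 2)⁻¹ • segBody (stdVec i + δ ^ 2 • stdVec j))
      ((δ ^ 2)⁻¹ • segBody (stdVec i))
    have hsup : ⨆ u : Sph n, |supportFn ((δ ^ 2)⁻¹ • segBody (stdVec i + δ ^ 2 • stdVec j)) u -
        supportFn ((δ ^ 2)⁻¹ • segBody (stdVec i)) u| ≤ 1 := by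
      refine Real.iSup_le (fun u => ?_) zero_le_one
      rw [supportFn_body_smul _ hinv, supportFn_body_smul _ hinv, ← mul_sub, abs_mul,
        abs_of_nonneg hinv]
      have h1 := abs_supportFn_segBody_sub_le (stdVec i + δ ^ 2 • stdVec j) (stdVec i) u
      have h2 : ‖stdVec i + δ ^ 2 • stdVec j - stdVec i‖ = δ ^ 2 := by
        rw [add_sub_cancel_left, norm_smul, (EuclideanSpace.basisFun (Fin n) ℝ).norm_eq_one,
          mul_one, Real.norm_of_nonneg (sq_nonneg δ)]
      rw [h2] at h1
      calc _ ≤ (δ ^ 2)⁻¹ * δ ^ 2 := mul_le_mul_of_nonneg_left h1 hinv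
        _ = 1 := inv_mul_cancel₀ (by positivity)
    have hsup0 : 0 ≤ ⨆ u : Sph n, |supportFn ((δ ^ 2)⁻¹ • segBody (stdVec i + δ ^ 2 • stdVec j)) u -
        supportFn ((δ ^ 2)⁻¹ • segBody (stdVec i)) u| := Real.iSup_nonneg fun u => abs_nonneg _
    have hle : |μ ((δ ^ 2)⁻¹ • segBody (stdVec i + δ ^ 2 • stdVec j)) -
        μ ((δ ^ 2)⁻¹ • segBody (stdVec i))| ≤ |C| := by
      refine h.trans ((mul_le_mul_of_nonneg_right (le_abs_self C) hsup0).trans ?_)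
      exact mul_le_of_le_one_right (abs_nonneg C) hsup
    have h3 := mul_le_mul_of_nonneg_left ((le_abs_self _).trans hle) hn0.le
    rw [mul_sub, hμ, hμ, areaCLM_smul hn _ hinv, areaCLM_smul hn _ hinv, smul_apply, smul_apply,
      areaCLM_profile_stdVec, smul_zero, sub_zero, smul_eq_mul, inv_mul_le_iff₀ (by positivity)] at h3
    have h4 := (tilt_le_areaCLM_profile hn hψ hψ_zero hψ_one i j hδ hδ2).trans h3
    rw [← hN] at h4
    refine le_of_mul_le_mul_left ?_ hδ
    linarith
  set a : ℝ := ((n - 1 : ℕ) : ℝ) * |C| with ha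
  have ha0 : 0 ≤ a := by positivity
  have hδ := key (min (1 / 2) (N / (4 * (a + 1)))) (lt_min (by norm_num) (by positivity))
    (min_le_left _ _)
  have h1 : a * min (1 / 2) (N / (4 * (a + 1))) ≤ a * (N / (4 * (a + 1))) :=
    mul_le_mul_of_nonneg_left (min_le_right _ _) ha0
  have h2 : a * (N / (4 * (a + 1))) ≤ N / 4 := by
    rw [mul_div_assoc', div_le_div_iff₀ (by positivity) (by norm_num)]
    nlinarith
  linarith

end Segments

end AreaVal

end

theorem mainTheorem6 (n : ℕ) (hn : 2 ≤ n) (ψ : ℝ → ℝ)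
    (hψ : ContDiffOn ℝ ∞ ψ (Set.Icc (-1) 1))
    (hψ_zero : ∀ t ∈ Set.Icc (-1 : ℝ) 1, 2 / 3 ≤ |t| → ψ t = 0)
    (hψ_one : ∀ t ∈ Set.Icc (-1 : ℝ) 1, |t| ≤ 1 / 3 → ψ t = 1)
    (μ : AreaVal.Body n → ℝ)
    (hμ : ∀ K : AreaVal.Body n, μ K =
      ∫ x : AreaVal.Sph n, AreaVal.profile n ψ ((x : AreaVal.E n) ⟨n - 1, by omega⟩)
        ∂(AreaVal.areaMeasure 1 K)) :
    AreaVal.IsVal 1 μ ∧ ¬ AreaVal.IsUniformlyContinuous μ := by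
  have hμ' : ∀ K, ((n - 1 : ℕ) : ℝ) * μ K = AreaVal.areaCLM K (AreaVal.oneIdx hn)
      (AreaVal.profileC hψ.continuousOn hψ_zero ⟨n - 1, by omega⟩) := fun K => by
    rw [hμ, ← AreaVal.integral_areaMeasure]
    rfl
  exact ⟨AreaVal.isVal_integral_areaMeasure hn _ hμ',
    AreaVal.not_isUniformlyContinuous_profile hn hψ.continuousOn hψ_zero hψ_one _ hμ'⟩
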